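/- Let $\mathbb{D}$ be the open unit disk in $\mathbb{C}$, $\mathbb{T}$ the unit circle, and let $\phi$ be an $N\times N$ matrix valued rational inner function on the bidisk $\mathbb{D}^2$. That is, $\phi$ is holomorphic on $\mathbb{D}^2$ with values of operator norm at most $1$, its radial boundary limits $\lim_{r\nearrow 1}\phi(re^{i\theta_1},re^{i\theta_2})$ exist and are unitary for almost every $(\theta_1,\theta_2)\in[0,2\pi]^2$, and $\phi = Q/p$ on $\mathbb{D}^2$ for some $N\times N$ matrix $Q$ with entries in $\mathbb{C}[z_1,z_2]$ and some $p\in\mathbb{C}[z_1,z_2]$ with no zeros in $\mathbb{D}^2$. Write $\det\phi=\tilde g/g$ in lowest terms, i.e. $g,\tilde g\in\mathbb{C}[z_1,z_2]$ have no common factor and $g$ has no zeros in $\mathbb{D}^2$. For $j=1,2$ let $d_j$ be the degree of $\tilde g$ in the variable $z_j$, and put $|d|=d_1+d_2$. Then there exists an $(N+|d|)\times(N+|d|)$ unitary matrix $$U=\begin{pmatrix}A&B\\ C&D\end{pmatrix}:\ \mathbb{C}^N\oplus\mathbb{C}^{|d|}\to\mathbb{C}^N\oplus\mathbb{C}^{|d|}$$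 such that $$\phi(z)=A+B\,d(z)\,(I-D\,d(z))^{-1}C\qquad\text{for all } z=(z_1,z_2)\in\mathbb{D}^2,$$ where $d(z)=\begin{pmatrix}z_1I_{d_1}&0\\0&z_2I_{d_2}\end{pmatrix}$. Furthermore, $(N+|d|)\times(N+|d|)$ is the minimum possible size of such a representation: if $k_1,k_2\ge 0$ are integers and $\phi$ has on $\mathbb{D}^2$ a representation of the same form with a unitary matrix of size $(N+k_1+k_2)\times(N+k_1+k_2)$ and with $\operatorname{diag}(z_1I_{k_1},z_2I_{k_2})$ in place of $d(z)$, then $N+k_1+k_2\ge N+d_1+d_2$. -/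

import Mathlib

open scoped Topology Matrix
open MeasureTheory

namespace BidiskInner

/-- The open bidisk `𝔻²` in `ℂ²`; the coordinates are `z 0` and `z 1`. -/
def bidisk : Set (Fin 2 → ℂ) := {z | ∀ j, ‖z j‖ < 1}

/-- The point `(r e^{iθ₁}, r e^{iθ₂})`. -/
noncomputable def radialPoint (r : ℝ) (θ : Fin 2 → ℝ) : Fin 2 → ℂ :=
  fun j => (r : ℂ) * Complex.exp ((θ j : ℂ) * Complex.I)

/-- `φ` is a matrix valued inner function on the bidisk: it is holomorphic there, its values are
contractions in the Euclidean operator norm, and its radial boundary limits exist and are unitary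
at almost every point of the torus. Only the values of `φ` on the bidisk matter. -/
structure IsInner {N : ℕ} (φ : (Fin 2 → ℂ) → Matrix (Fin N) (Fin N) ℂ) : Prop where
  holomorphic : ∀ i j, DifferentiableOn ℂ (fun z => φ z i j) bidisk
  contractive : ∀ z ∈ bidisk, ‖Matrix.toEuclideanCLM (n := Fin N) (𝕜 := ℂ) (φ z)‖ ≤ 1
  unitary_boundary :
    ∀ᵐ θ ∂(volume.restrict (Set.Icc (0 : Fin 2 → ℝ) (fun _ => 2 * Real.pi))),
      ∃ V ∈ Matrix.unitaryGroup (Fin N) ℂ,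
        Filter.Tendsto (fun r : ℝ => φ (radialPoint r θ)) (𝓝[<] 1) (𝓝 V)

/-- `φ` is rational on the bidisk: `φ = Q / p` for a matrix polynomial `Q` and a polynomial `p`
without zeros in the bidisk. -/
def IsRationalOnBidisk {N : ℕ} (φ : (Fin 2 → ℂ) → Matrix (Fin N) (Fin N) ℂ) : Prop :=
  ∃ (Q : Matrix (Fin N) (Fin N) (MvPolynomial (Fin 2) ℂ)) (p : MvPolynomial (Fin 2) ℂ),
    (∀ z ∈ bidisk, MvPolynomial.eval z p ≠ 0) ∧
    ∀ z ∈ bidisk, ∀ i j, φ z i j = MvPolynomial.eval z (Q i j) / MvPolynomial.eval z p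

/-- An `N × N` matrix valued rational inner function on the bidisk. -/
def IsRationalInner {N : ℕ} (φ : (Fin 2 → ℂ) → Matrix (Fin N) (Fin N) ℂ) : Prop :=
  IsInner φ ∧ IsRationalOnBidisk φ

/-- `f = gt / g` on the bidisk in lowest terms: `g` has no zeros in the bidisk, and `g` and `gt`
have no common factor. -/
structure IsLowestTerms (f : (Fin 2 → ℂ) → ℂ) (gt g : MvPolynomial (Fin 2) ℂ) : Prop where
  ne_zero : ∀ z ∈ bidisk, MvPolynomial.eval z g ≠ 0
  relPrime : IsRelPrime gt g
  eq_div : ∀ z ∈ bidisk, f z = MvPolynomial.eval z gt / MvPolynomial.eval z g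

/-- The block diagonal matrix `d(z) = diag(z₁ I, z₂ I)`, with blocks of sizes `k₁` and `k₂`. -/
def blockDiag (k₁ k₂ : ℕ) (z : Fin 2 → ℂ) : Matrix (Fin k₁ ⊕ Fin k₂) (Fin k₁ ⊕ Fin k₂) ℂ :=
  Matrix.fromBlocks (z 0 • (1 : Matrix (Fin k₁) (Fin k₁) ℂ)) 0 0
    (z 1 • (1 : Matrix (Fin k₂) (Fin k₂) ℂ))

/-- The transfer function `A + B d(z) (I - D d(z))⁻¹ C` of the block matrix
`U = [[A, B], [C, D]]` on `ℂ^N ⊕ (ℂ^k₁ ⊕ ℂ^k₂)`. If `U` is unitary and `z` is in the bidisk, then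
`D d(z)` has norm less than one, so the matrix being inverted is invertible. -/
noncomputable def transferFunction {N k₁ k₂ : ℕ}
    (U : Matrix (Fin N ⊕ (Fin k₁ ⊕ Fin k₂)) (Fin N ⊕ (Fin k₁ ⊕ Fin k₂)) ℂ) (z : Fin 2 → ℂ) :
    Matrix (Fin N) (Fin N) ℂ :=
  U.toBlocks₁₁ +
    U.toBlocks₁₂ * blockDiag k₁ k₂ z * (1 - U.toBlocks₂₂ * blockDiag k₁ k₂ z)⁻¹ * U.toBlocks₂₁

/-- `φ` has a unitary transfer function realization of size `N + (k₁ + k₂)`. -/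
def HasRealization {N : ℕ} (φ : (Fin 2 → ℂ) → Matrix (Fin N) (Fin N) ℂ) (k₁ k₂ : ℕ) : Prop :=
  ∃ U ∈ Matrix.unitaryGroup (Fin N ⊕ (Fin k₁ ⊕ Fin k₂)) ℂ,
    ∀ z ∈ bidisk, φ z = transferFunction U z

end BidiskInner

/-! Write `y` for `z 0` and `x` for `z 1`, and `φ = Q / p`. For generic `x` on the circle, `φ` is a
rational inner function of `y` alone. Splitting off one Blaschke–Potapov factor per zero of its
determinant in the disc writes its kernel as a sum of at most `gt.degreeOf 0` squares
(`exists_kernel`). The squares are chosen separately for each `x`, but the Gram matrix `T x` of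
their coefficients depends only on `Q` and `p`, so its entries are trigonometric polynomials in `x`.
A matrix Fejér–Riesz factorization of `T`, with an outer factor having no more rows than the generic
rank, turns the squares into polynomials `E` in both variables, up to a scalar denominator `c`
(`exists_outer_factorization`, `exists_state`).

The stacked matrices `(c p, y E)` and `(c Q, E)` now have equal Gram kernels for generic `x` on the
circle, so a unitary-valued rational function `V / q` of `x` alone carries one to the other.
Outerness rules out poles in the disc, so `V / q` is again inner (`exists_intertwiner`), and its own
kernel supplies the squares for the second variable. Their number is the number of zeros of `V.det`
in the disc. By `det_intertwiner`, `V.det` times `g` at `y = 0` is, up to sign, the leading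
coefficient of `gt` in `y` times a power of `q`, so there are at most `gt.degreeOf 1` of them. The
two families form an Agler decomposition (`exists_colligation`), and the lurking isometry argument
converts it into the unitary `U`.

Conversely, the Schur complement writes the determinant of any transfer function as a quotient of
polynomial determinants whose numerator has degree at most `k₁` in `z 0` and `k₂` in `z 1`; since
`gt / g` is in lowest terms, `gt` divides that numerator (`degreeOf_le_of_hasRealization`). -/

namespace BidiskInner

open Polynomial Filter
open scoped ComplexOrder

/-! ### Generic points of the unit circle -/

/-- The filter of cofinite subsets of the unit circle. -/
def circleGen : Filter ℂ := cofinite ⊓ 𝓟 (Metric.sphere (0 : ℂ) 1)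

/-- A connected set with more than one point has no isolated points. Hence closed conditions that
hold at generic points of the circle hold at all of them. -/
lemma nhdsWithin_circle_neBot {x : ℂ} (hx : ‖x‖ = 1) :
    (𝓝[≠] x ⊓ 𝓟 (Metric.sphere (0 : ℂ) 1)).NeBot := by
  have h1 : IsPreconnected (Metric.sphere (0 : ℂ) 1) :=
    isPreconnected_sphere (by rw [Complex.rank_real_complex]; norm_num) _ _
  have h2 : (Metric.sphere (0 : ℂ) 1).Nontrivial :=
    ⟨1, by simp, -1, by simp, by norm_num⟩
  exact (IsPreconnected.preperfect_of_nontrivial h2 h1) x (by simpa using hx)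

lemma nhdsWithin_circle_le (x : ℂ) : 𝓝[≠] x ⊓ 𝓟 (Metric.sphere (0 : ℂ) 1) ≤ circleGen :=
  inf_le_inf_right _ (by rw [Filter.le_cofinite_iff_compl_singleton_mem]
                         intro y
                         by_cases h : y = x
                         · subst h; exact self_mem_nhdsWithin
                         · exact mem_nhdsWithin_of_mem_nhds
                            (isOpen_compl_singleton.mem_nhds (by simpa using Ne.symm h)))

instance circleGen_neBot : circleGen.NeBot :=
  haveI := nhdsWithin_circle_neBot (x := 1) (by simp)
  Filter.NeBot.mono this (nhdsWithin_circle_le 1)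

lemma eventually_circle : ∀ᶠ x in circleGen, ‖x‖ = 1 := by
  have : Metric.sphere (0 : ℂ) 1 ∈ circleGen := mem_inf_of_right (mem_principal_self _)
  filter_upwards [this] with x hx
  simpa using hx

lemma eventually_of_circle {P : ℂ → Prop} (h : ∀ x, ‖x‖ = 1 → P x) : ∀ᶠ x in circleGen, P x :=
  eventually_circle.mono h

lemma eventually_eval_ne_zero {p : ℂ[X]} (hp : p ≠ 0) : ∀ᶠ x in circleGen, p.eval x ≠ 0 := by
  have h : {x | p.eval x ≠ 0} ∈ (cofinite : Filter ℂ) := by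
    rw [mem_cofinite]
    refine (p.roots.toFinset.finite_toSet).subset ?_
    intro x hx
    replace hx : p.eval x = 0 := by simpa using hx
    simp [hp, hx]
  exact mem_inf_of_left h

lemma poly_eq_of_frequently {p q : ℂ[X]} (h : ∃ᶠ x in circleGen, p.eval x = q.eval x) :
    p = q := by
  by_contra hne
  have := eventually_eval_ne_zero (sub_ne_zero.2 hne)
  refine h (this.mono fun x hx => ?_)
  simpa [sub_eq_zero] using hx

lemma poly_eq_of_eventually {p q : ℂ[X]} (h : ∀ᶠ x in circleGen, p.eval x = q.eval x) :
    p = q := poly_eq_of_frequently h.frequently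

lemma poly_eq_of_disc {p q : ℂ[X]} (h : ∀ x : ℂ, ‖x‖ < 1 → p.eval x = q.eval x) : p = q := by
  refine Polynomial.eq_of_infinite_eval_eq _ _ ?_
  refine Set.Infinite.mono (s := Metric.ball (0 : ℂ) 1) (fun x hx => h x (by simpa using hx)) ?_
  exact infinite_of_mem_nhds (0 : ℂ) (Metric.ball_mem_nhds _ one_pos)

lemma closed_of_eventually {s : Set ℂ} (hs : IsClosed s) (h : ∀ᶠ x in circleGen, x ∈ s) {x : ℂ}
    (hx : ‖x‖ = 1) : x ∈ s := by
  have := nhdsWithin_circle_neBot hx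
  refine hs.mem_of_tendsto (f := id) (b := 𝓝[≠] x ⊓ 𝓟 (Metric.sphere (0 : ℂ) 1)) ?_
    ((h.filter_mono (nhdsWithin_circle_le x)))
  exact tendsto_id.mono_left (inf_le_left.trans nhdsWithin_le_nhds)

lemma eq_of_eventually {Y : Type*} [TopologicalSpace Y] [T2Space Y] {f g : ℂ → Y}
    (hf : Continuous f) (hg : Continuous g)
    (h : ∀ᶠ x in circleGen, f x = g x) {x : ℂ} (hx : ‖x‖ = 1) : f x = g x :=
  closed_of_eventually (s := {x | f x = g x}) (isClosed_eq hf hg) h hx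

/-! ### Evaluation of polynomial matrices -/

/-- Evaluation of a matrix of polynomials. -/
def evalM {m n : Type*} (x : ℂ) (Q : Matrix m n ℂ[X]) : Matrix m n ℂ := Q.map (Polynomial.eval x)

section evalM
variable {m n k : Type*}

@[simp] lemma evalM_apply (x : ℂ) (Q : Matrix m n ℂ[X]) (i : m) (j : n) :
    evalM x Q i j = (Q i j).eval x := rfl

lemma evalM_mul [Fintype n] (x : ℂ) (Q : Matrix m n ℂ[X]) (R : Matrix n k ℂ[X]) :
    evalM x (Q * R) = evalM x Q * evalM x R := by
  ext i j
  simp [Matrix.mul_apply, Polynomial.eval_finsetSum]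

lemma evalM_smul (x : ℂ) (p : ℂ[X]) (Q : Matrix m n ℂ[X]) :
    evalM x (p • Q) = p.eval x • evalM x Q := by
  ext i j; simp

@[simp] lemma evalM_one [DecidableEq n] (x : ℂ) : evalM x (1 : Matrix n n ℂ[X]) = 1 := by
  ext a b
  by_cases h : a = b <;> simp [Matrix.one_apply, h]

@[simp] lemma evalM_zero (x : ℂ) : evalM x (0 : Matrix m n ℂ[X]) = 0 := by
  ext a b; simp

lemma evalM_map_C (x : ℂ) (Q : Matrix m n ℂ) : evalM x (Q.map C) = Q := by
  ext i j; simp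

lemma det_evalM [Fintype n] [DecidableEq n] (x : ℂ) (Q : Matrix n n ℂ[X]) :
    (evalM x Q).det = Q.det.eval x := by
  have := RingHom.map_det (Polynomial.evalRingHom x) Q
  simpa [evalM] using this.symm

lemma adjugate_evalM [Fintype n] [DecidableEq n] (x : ℂ) (Q : Matrix n n ℂ[X]) :
    (evalM x Q).adjugate = evalM x Q.adjugate := by
  have := RingHom.map_adjugate (Polynomial.evalRingHom x) Q
  exact this.symm

lemma polyMatrix_eq_of_eventually {Q R : Matrix m n ℂ[X]}
    (h : ∀ᶠ x in circleGen, evalM x Q = evalM x R) : Q = R := by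
  ext1 i j
  exact poly_eq_of_eventually (h.mono fun x hx => congrFun (congrFun hx i) j)

lemma continuous_evalM (Q : Matrix m n ℂ[X]) : Continuous fun x => evalM x Q :=
  continuous_matrix fun i j => (Q i j).continuous

end evalM

/-! ### Zeros in the disc and reflected factors -/

open Classical in
/-- The number of roots of a polynomial in the open unit disc, with multiplicity. -/
noncomputable def discRoots (f : ℂ[X]) : ℕ := f.roots.countP (fun z => ‖z‖ < 1)

lemma discRoots_mul {f g : ℂ[X]} (hf : f ≠ 0) (hg : g ≠ 0) :
    discRoots (f * g) = discRoots f + discRoots g := by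
  classical
  rw [discRoots, Polynomial.roots_mul (mul_ne_zero hf hg), Multiset.countP_add]; rfl

lemma discRoots_le_natDegree (f : ℂ[X]) : discRoots f ≤ f.natDegree := by
  classical
  exact (Multiset.countP_le_card _ _).trans f.card_roots'

lemma discRoots_eq_zero_iff {f : ℂ[X]} (hf : f ≠ 0) :
    discRoots f = 0 ↔ ∀ z : ℂ, ‖z‖ < 1 → f.eval z ≠ 0 := by
  classical
  rw [discRoots, Multiset.countP_eq_zero]
  constructor
  · intro h z hz h0
    exact h z ((Polynomial.mem_roots hf).2 h0) hz
  · intro h z hz hz1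
    exact h z hz1 ((Polynomial.mem_roots hf).1 hz)

lemma discRoots_of_ne_zero {f : ℂ[X]} (hf : ∀ z : ℂ, ‖z‖ < 1 → f.eval z ≠ 0) :
    discRoots f = 0 := by
  refine (discRoots_eq_zero_iff ?_).2 hf
  rintro rfl
  exact hf 0 (by simp) (by simp)

lemma discRoots_X_sub_C {a : ℂ} (ha : ‖a‖ < 1) : discRoots (X - C a) = 1 := by
  classical
  rw [discRoots, Polynomial.roots_X_sub_C, Multiset.countP_eq_card.2 (by simpa using ha)]
  simp

/-- The reversed factor `1 - conj a * X`. -/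
noncomputable def refl (a : ℂ) : ℂ[X] := 1 - C (starRingEnd ℂ a) * X

lemma eval_refl (a x : ℂ) : (refl a).eval x = 1 - starRingEnd ℂ a * x := by simp [refl]

lemma eval_refl_ne_zero {a x : ℂ} (ha : ‖a‖ < 1) (hx : ‖x‖ ≤ 1) : (refl a).eval x ≠ 0 := by
  rw [eval_refl]
  intro h
  have h1 : starRingEnd ℂ a * x = 1 := (sub_eq_zero.1 h).symm
  have h2 : ‖a‖ * ‖x‖ = 1 := by
    rw [← RCLike.norm_conj a, ← norm_mul, h1, norm_one]
  nlinarith [norm_nonneg a, norm_nonneg x]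

lemma refl_ne_zero {a : ℂ} (ha : ‖a‖ < 1) : refl a ≠ 0 := by
  intro h
  have := eval_refl_ne_zero (a := a) (x := 0) ha (by simp)
  simp [h] at this

lemma conj_mul_self_of_norm {x : ℂ} (hx : ‖x‖ = 1) : starRingEnd ℂ x * x = 1 := by
  rw [← Complex.normSq_eq_conj_mul_self, Complex.normSq_eq_norm_sq, hx]; simp

lemma ne_zero_of_norm_one {x : ℂ} (hx : ‖x‖ = 1) : x ≠ 0 := by
  rintro rfl; simp at hx

/-! ### Unitaries from equal Gram kernels -/

/-- Families of matrices with the same Gram kernel differ by a unitary matrix. -/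
theorem exists_unitary_of_gram {ι m n : Type*} [Finite m] [Fintype n] [DecidableEq n]
    (X Y : ι → Matrix n m ℂ) (h : ∀ a b, (X a)ᴴ * X b = (Y a)ᴴ * Y b) :
    ∃ U ∈ Matrix.unitaryGroup n ℂ, ∀ a, U * X a = Y a := by
  classical
  have := Fintype.ofFinite m
  let x : ι × m → EuclideanSpace ℂ n := fun a => WithLp.toLp 2 fun i => X a.1 i a.2
  let y : ι × m → EuclideanSpace ℂ n := fun a => WithLp.toLp 2 fun i => Y a.1 i a.2
  have hxy : ∀ a b, inner ℂ (x a) (x b) = inner ℂ (y a) (y b) := by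
    intro a b
    have := congrFun (congrFun (h a.1 b.1) a.2) b.2
    simp only [Matrix.mul_apply, Matrix.conjTranspose_apply] at this
    simp only [x, y, PiLp.inner_apply, RCLike.inner_apply]
    simpa [mul_comm] using this
  let Lx : (ι × m →₀ ℂ) →ₗ[ℂ] EuclideanSpace ℂ n := Finsupp.linearCombination ℂ x
  let Ly : (ι × m →₀ ℂ) →ₗ[ℂ] EuclideanSpace ℂ n := Finsupp.linearCombination ℂ y
  have hin : ∀ c d, inner ℂ (Lx c) (Lx d) = inner ℂ (Ly c) (Ly d) := by
    intro c d
    simp only [Lx, Ly, Finsupp.linearCombination_apply, Finsupp.sum_inner, Finsupp.inner_sum,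
      inner_smul_left, inner_smul_right, hxy]
  have hnorm : ∀ c, ‖Ly c‖ = ‖Lx c‖ := by
    intro c
    have h1 := hin c c
    rw [inner_self_eq_norm_sq_to_K, inner_self_eq_norm_sq_to_K] at h1
    have h2 : ‖Lx c‖ ^ 2 = ‖Ly c‖ ^ 2 := by exact_mod_cast h1
    exact ((sq_eq_sq₀ (norm_nonneg _) (norm_nonneg _)).1 h2).symm
  -- Equality of norms makes `Lx c ↦ Ly c` well defined on the span of the `x a`.
  have hker : LinearMap.ker Lx ≤ LinearMap.ker Ly := by
    intro c hc
    rw [LinearMap.mem_ker] at hc ⊢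
    rw [← norm_eq_zero, hnorm, hc, norm_zero]
  let T : LinearMap.range Lx →ₗ[ℂ] EuclideanSpace ℂ n :=
    (Submodule.liftQ _ Ly hker) ∘ₗ (Lx.quotKerEquivRange.symm : LinearMap.range Lx →ₗ[ℂ] _)
  have hT : ∀ c, T ⟨Lx c, LinearMap.mem_range_self _ c⟩ = Ly c := by
    intro c
    simp only [T, LinearMap.comp_apply, LinearEquiv.coe_coe]
    have := Lx.quotKerEquivRange_symm_apply_image c (LinearMap.mem_range_self _ c)
    rw [this]
    simp
  let Ti : LinearMap.range Lx →ₗᵢ[ℂ] EuclideanSpace ℂ n := ⟨T, by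
    rintro ⟨_, c, rfl⟩
    rw [hT]; exact hnorm c⟩
  -- In finite dimension the orthogonal complements of the span and of its image have the same
  -- dimension, so the isometry extends to the whole space.
  let S : EuclideanSpace ℂ n →ₗᵢ[ℂ] EuclideanSpace ℂ n := Ti.extend
  have hS : ∀ a, S (x a) = y a := by
    intro a
    have hx : Lx (Finsupp.single a 1) = x a := by simp [Lx]
    have hy : Ly (Finsupp.single a 1) = y a := by simp [Ly]
    have h1 := LinearIsometry.extend_apply Ti ⟨Lx (Finsupp.single a 1), LinearMap.mem_range_self _ _⟩
    have h2 := hT (Finsupp.single a 1)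
    simp only [hx, hy] at h1 h2
    rw [← h2]; exact h1
  let U : Matrix n n ℂ := Matrix.of fun i j => S (EuclideanSpace.single j 1) i
  have hU : ∀ v : EuclideanSpace ℂ n, ∀ i, S v i = ∑ j, U i j * v j := by
    intro v i
    have hv : v = ∑ j, v j • EuclideanSpace.single j (1 : ℂ) := by
      ext k
      simp [Finset.sum_apply, Pi.single_apply]
    conv_lhs => rw [hv]
    simp [map_sum, U, WithLp.ofLp_sum, Finset.sum_apply, mul_comm]
  refine ⟨U, ?_, ?_⟩
  · rw [Matrix.mem_unitaryGroup_iff']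
    ext i j
    have h1 := S.inner_map_map (EuclideanSpace.single i 1) (EuclideanSpace.single j 1)
    simp only [PiLp.inner_apply, RCLike.inner_apply] at h1
    rw [Matrix.mul_apply]
    simp only [Matrix.star_apply, U, Matrix.of_apply, RCLike.star_def]
    rw [Finset.sum_congr rfl fun k _ => mul_comm _ _]
    rw [h1]
    simp [Matrix.one_apply, eq_comm]
  · intro a
    ext i j
    have h1 := hU (x (a, j)) i
    rw [hS] at h1
    simp only [x, y] at h1
    rw [Matrix.mul_apply]
    exact h1.symm

/-- The matrix `F` with the row `r` put on top. -/
def consRow {α κ : Type*} {n : ℕ} (r : κ → α) (F : Matrix (Fin n) κ α) :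
    Matrix (Fin (n + 1)) κ α := fun i j => Fin.cases (r j) (fun i => F i j) i

@[simp] lemma consRow_zero {α κ : Type*} {n : ℕ} (r : κ → α) (F : Matrix (Fin n) κ α) (j : κ) :
    consRow r F 0 j = r j := rfl

@[simp] lemma consRow_succ {α κ : Type*} {n : ℕ} (r : κ → α) (F : Matrix (Fin n) κ α) (i : Fin n)
    (j : κ) : consRow r F i.succ j = F i j := rfl

/-! ### Blaschke–Potapov factors and outer matrices -/

section Extraction
variable {m κ : Type*} [Fintype m]

lemma exists_unit_left_null {M : Matrix m κ ℂ} {v : m → ℂ} (hv : v ≠ 0) (h : v ᵥ* M = 0) :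
    ∃ u : m → ℂ, ∑ i, starRingEnd ℂ (u i) * u i = 1 ∧
      ∀ j, ∑ i, starRingEnd ℂ (u i) * M i j = 0 := by
  set s : ℝ := ∑ i, ‖v i‖ ^ 2 with hs
  have hpos : 0 < s := by
    obtain ⟨i, hi⟩ := Function.ne_iff.1 hv
    refine Finset.sum_pos' (fun i _ => by positivity) ⟨i, Finset.mem_univ _, ?_⟩
    have : 0 < ‖v i‖ := norm_pos_iff.2 hi
    positivity
  have hsq : ((Real.sqrt s : ℝ) : ℂ) * (Real.sqrt s : ℝ) = s := by
    rw [← Complex.ofReal_mul, Real.mul_self_sqrt hpos.le]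
  have hne : ((Real.sqrt s : ℝ) : ℂ) ≠ 0 := by
    rw [Complex.ofReal_ne_zero]; exact (Real.sqrt_pos.2 hpos).ne'
  refine ⟨fun i => ((Real.sqrt s : ℝ) : ℂ)⁻¹ * starRingEnd ℂ (v i), ?_, fun j => ?_⟩
  · have h1 : ∀ i, starRingEnd ℂ (((Real.sqrt s : ℝ) : ℂ)⁻¹ * starRingEnd ℂ (v i)) *
        (((Real.sqrt s : ℝ) : ℂ)⁻¹ * starRingEnd ℂ (v i)) =
        (s : ℂ)⁻¹ * ((‖v i‖ ^ 2 : ℝ) : ℂ) := by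
      intro i
      rw [← hsq, map_mul, map_inv₀, Complex.conj_ofReal, Complex.conj_conj, Complex.ofReal_pow,
        ← Complex.mul_conj']
      field_simp
    rw [Finset.sum_congr rfl fun i _ => h1 i, ← Finset.mul_sum, ← Complex.ofReal_sum, ← hs]
    exact inv_mul_cancel₀ (by exact_mod_cast hpos.ne')
  · have h1 := congrFun h j
    simp only [Matrix.vecMul, dotProduct, Pi.zero_apply] at h1
    simp only [map_mul, map_inv₀, Complex.conj_ofReal, Complex.conj_conj, mul_assoc]
    rw [← Finset.mul_sum, h1, mul_zero]

/-- Extraction of an elementary Blaschke–Potapov factor. -/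
theorem exists_extraction [DecidableEq m] (E : Matrix m κ ℂ[X]) {a : ℂ} (u : m → ℂ)
    (hu : ∑ i, starRingEnd ℂ (u i) * u i = 1)
    (h0 : ∀ j, ∑ i, starRingEnd ℂ (u i) * evalM a E i j = 0) :
    ∃ (E' : Matrix m κ ℂ[X]) (R : κ → ℂ[X]),
      (∀ w z j l, ((evalM w E')ᴴ * evalM z E') j l - ((evalM w E)ᴴ * evalM z E) j l =
        (1 - z * starRingEnd ℂ w) * (1 - starRingEnd ℂ a * a) *
          (starRingEnd ℂ ((R j).eval w) * (R l).eval z)) ∧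
      ∀ [Fintype κ] (K : Matrix κ m ℂ[X]),
        (E' * K).det * (X - C a) = (E * K).det * refl a := by
  have hdvd : ∀ j, ∃ R : ℂ[X], ∑ i, C (starRingEnd ℂ (u i)) * E i j = (X - C a) * R := by
    intro j
    refine (Polynomial.dvd_iff_isRoot).2 ?_
    have := h0 j
    simpa [Polynomial.IsRoot, Polynomial.eval_finsetSum] using this
  choose R hR using hdvd
  have hRz : ∀ z j, ∑ i, starRingEnd ℂ (u i) * (E i j).eval z = (z - a) * (R j).eval z := by
    intro z j
    have := congrArg (Polynomial.eval z) (hR j)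
    simpa [Polynomial.eval_finsetSum] using this
  -- In the direction `u`, the factor `X - C a` of `u* E = (X - C a) R` is exchanged for `refl a`;
  -- the orthogonal complement of `u` is untouched. On the circle the two factors have the same
  -- modulus.
  let E' : Matrix m κ ℂ[X] := Matrix.of fun i j => E i j + C (u i) * ((refl a - (X - C a)) * R j)
  have hE' : ∀ z i j, (E' i j).eval z =
      (E i j).eval z + u i * ((1 - starRingEnd ℂ a * z - (z - a)) * (R j).eval z) := by
    intro z i j
    simp [E', eval_refl]
  refine ⟨E', R, ?_, ?_⟩
  · intro w z j l
    simp only [Matrix.mul_apply, Matrix.conjTranspose_apply, evalM_apply, hE', RCLike.star_def]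
    have h1 : ∀ i, starRingEnd ℂ ((E i j).eval w + u i *
        ((1 - starRingEnd ℂ a * w - (w - a)) * (R j).eval w)) *
        ((E i l).eval z + u i * ((1 - starRingEnd ℂ a * z - (z - a)) * (R l).eval z)) =
        starRingEnd ℂ ((E i j).eval w) * (E i l).eval z +
        starRingEnd ℂ ((1 - starRingEnd ℂ a * w - (w - a)) * (R j).eval w) *
          (starRingEnd ℂ (u i) * (E i l).eval z) +
        ((1 - starRingEnd ℂ a * z - (z - a)) * (R l).eval z) *
          starRingEnd ℂ (starRingEnd ℂ (u i) * (E i j).eval w) +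
        starRingEnd ℂ ((1 - starRingEnd ℂ a * w - (w - a)) * (R j).eval w) *
          ((1 - starRingEnd ℂ a * z - (z - a)) * (R l).eval z) *
          (starRingEnd ℂ (u i) * u i) := by
      intro i
      simp only [map_add, map_mul, Complex.conj_conj]
      ring
    rw [Finset.sum_congr rfl fun i _ => h1 i]
    simp only [Finset.sum_add_distrib, ← Finset.mul_sum, ← map_sum, hRz, hu]
    simp only [map_mul, map_sub, map_one, Complex.conj_conj]
    ring
  · intro _ K
    refine poly_eq_of_eventually ?_
    filter_upwards [eventually_eval_ne_zero (X_sub_C_ne_zero a)] with x hx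
    rw [eval_mul, eval_mul, ← det_evalM, ← det_evalM, evalM_mul, evalM_mul]
    have hxa : x - a ≠ 0 := by simpa using hx
    -- Here `1 + k` is the inverse Blaschke factor at `a`. It is the determinant of the rank-one
    -- update `1 + k u u*` because `u` is a unit vector.
    let k : ℂ := (1 - starRingEnd ℂ a * x - (x - a)) / (x - a)
    have h1 : evalM x E' = (1 + Matrix.replicateCol Unit (k • u) *
        Matrix.replicateRow Unit (star u)) * evalM x E := by
      rw [Matrix.add_mul, Matrix.one_mul]
      ext i j
      rw [evalM_apply, hE', Matrix.add_apply, evalM_apply, Matrix.mul_assoc, Matrix.mul_apply]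
      simp only [Finset.univ_unique, Finset.sum_singleton, Matrix.replicateCol_apply,
        Matrix.mul_apply, Matrix.replicateRow_apply, Pi.smul_apply, Pi.star_apply, evalM_apply,
        RCLike.star_def, hRz, smul_eq_mul, k]
      field_simp
    have h2 : star u ⬝ᵥ (k • u) = k := by
      rw [dotProduct_smul]
      simp only [dotProduct, Pi.star_apply, RCLike.star_def, hu, smul_eq_mul, mul_one]
    rw [h1, Matrix.mul_assoc, Matrix.det_mul, Matrix.det_one_add_replicateCol_mul_replicateRow, h2,
      eval_refl]
    simp only [eval_sub, eval_X, eval_C, k]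
    field_simp
    ring

/-- The reflected factor `refl a` has no zero in the disc and `X - C a` has exactly one, so each
extraction lowers the count that drives the inductions. -/
lemma discRoots_extraction {f g : ℂ[X]} {a : ℂ} (ha : ‖a‖ < 1) (hg : g ≠ 0)
    (h : f * (X - C a) = g * refl a) : f ≠ 0 ∧ discRoots g = discRoots f + 1 := by
  have hf : f ≠ 0 := by
    rintro rfl
    rw [zero_mul] at h
    exact mul_ne_zero hg (refl_ne_zero ha) h.symm
  refine ⟨hf, ?_⟩
  have := congrArg discRoots h
  rw [discRoots_mul hf (X_sub_C_ne_zero a), discRoots_mul hg (refl_ne_zero ha),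
    discRoots_X_sub_C ha,
    discRoots_of_ne_zero (f := refl a) fun z hz => eval_refl_ne_zero ha hz.le] at this
  omega

/-- A polynomial matrix of full row rank can be replaced by one with the same Gram matrix on the
circle and with full row rank at every point of the disc. -/
theorem exists_outer [DecidableEq m] [Fintype κ] (K : Matrix κ m ℂ[X]) (E : Matrix m κ ℂ[X])
    (hK : (E * K).det ≠ 0) :
    ∃ E' : Matrix m κ ℂ[X],
      (∀ x : ℂ, ‖x‖ = 1 → (evalM x E')ᴴ * evalM x E' = (evalM x E)ᴴ * evalM x E) ∧
      ∀ x : ℂ, ‖x‖ < 1 → ∀ v : m → ℂ, v ᵥ* evalM x E' = 0 → v = 0 := by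
  -- `K` only serves to produce a square matrix: wherever the rows of `E` become dependent, `(E *
  -- K).det` vanishes, so its zeros in the disc bound the number of extractions needed.
  induction hn : discRoots (E * K).det generalizing E with
  | zero =>
    refine ⟨E, fun _ _ => rfl, fun x hx v hv => ?_⟩
    have h1 := (discRoots_eq_zero_iff hK).1 hn x hx
    rw [← det_evalM, evalM_mul] at h1
    refine Matrix.eq_zero_of_vecMul_eq_zero h1 ?_
    rw [← Matrix.vecMul_vecMul, hv, Matrix.zero_vecMul]
  | succ n ih =>
    by_cases hfull : ∀ x : ℂ, ‖x‖ < 1 → ∀ v : m → ℂ, v ᵥ* evalM x E = 0 → v = 0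
    · exact ⟨E, fun _ _ => rfl, hfull⟩
    push Not at hfull
    obtain ⟨a, ha, v, hv, hv0⟩ := hfull
    obtain ⟨u, hu, h0⟩ := exists_unit_left_null hv0 hv
    obtain ⟨E', R, hE, hdet⟩ := exists_extraction E u hu h0
    obtain ⟨hne, hd⟩ := discRoots_extraction ha hK (hdet K)
    obtain ⟨E'', h1, h2⟩ := ih E' hne (by omega)
    refine ⟨E'', fun x hx => ?_, h2⟩
    rw [h1 x hx]
    ext j l
    have := hE x x j l
    rw [mul_comm x, conj_mul_self_of_norm hx, sub_self, zero_mul, zero_mul, sub_eq_zero] at this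
    exact this

/-- Cancelling the common zeros of the entries of `Q` and of `q`. -/
theorem exists_reduced {m n : Type*} (Q : Matrix m n ℂ[X]) (q : ℂ[X]) (hq : q ≠ 0) :
    ∃ (Q' : Matrix m n ℂ[X]) (q' g : ℂ[X]), g ≠ 0 ∧ q' ≠ 0 ∧ q = g * q' ∧ Q = g • Q' ∧
      ∀ z, q'.eval z = 0 → evalM z Q' ≠ 0 := by
  induction hn : q.natDegree using Nat.strong_induction_on generalizing Q q with
  | _ d ih =>
    by_cases h : ∀ z, q.eval z = 0 → evalM z Q ≠ 0
    · exact ⟨Q, q, 1, one_ne_zero, hq, by simp, by simp, h⟩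
    push Not at h
    obtain ⟨a, ha, hQ⟩ := h
    obtain ⟨q₁, rfl⟩ := Polynomial.dvd_iff_isRoot.2 ha
    have hdvd : ∀ i j, ∃ r, Q i j = (X - C a) * r := fun i j =>
      Polynomial.dvd_iff_isRoot.2 (congrFun (congrFun hQ i) j)
    choose R hR using hdvd
    have hq₁ : q₁ ≠ 0 := right_ne_zero_of_mul hq
    have hdeg : q₁.natDegree < d := by
      rw [← hn, natDegree_mul (X_sub_C_ne_zero a) hq₁, natDegree_X_sub_C]; omega
    obtain ⟨Q', q', g, hg, hq', h1, h2, h3⟩ := ih _ hdeg (Matrix.of R) q₁ hq₁ rfl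
    refine ⟨Q', q', (X - C a) * g, mul_ne_zero (X_sub_C_ne_zero a) hg, hq', ?_, ?_, h3⟩
    · rw [h1]; ring
    · have : Q = (X - C a) • Matrix.of R := by
        ext1 i j
        simp [hR]
      rw [this, h2, smul_smul]

end Extraction

/-! ### Rational inner functions of one variable -/

section OneVariable
variable {m : Type*} [Fintype m]

lemma norm_toLp_mulVec_of_gram [DecidableEq m] {M : Matrix m m ℂ} {c : ℂ}
    (h : Mᴴ * M = (starRingEnd ℂ c * c) • (1 : Matrix m m ℂ)) (v : m → ℂ) :
    ‖WithLp.toLp 2 (M *ᵥ v)‖ = ‖c‖ * ‖WithLp.toLp 2 v‖ := by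
  have h1 : star (M *ᵥ v) ⬝ᵥ (M *ᵥ v) = starRingEnd ℂ c * c * (star v ⬝ᵥ v) := by
    rw [Matrix.star_mulVec, ← Matrix.dotProduct_mulVec, Matrix.mulVec_mulVec, h,
      Matrix.smul_mulVec, Matrix.one_mulVec, dotProduct_smul, smul_eq_mul]
  have h2 : ∀ w : m → ℂ, star w ⬝ᵥ w = ((‖WithLp.toLp 2 w‖ ^ 2 : ℝ) : ℂ) := by
    intro w
    rw [EuclideanSpace.norm_sq_eq, Complex.ofReal_sum]
    refine Finset.sum_congr rfl fun i _ => ?_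
    rw [Complex.ofReal_pow, ← Complex.conj_mul']; rfl
  rw [h2, h2, Complex.conj_mul'] at h1
  have h3 : ‖WithLp.toLp 2 (M *ᵥ v)‖ ^ 2 = (‖c‖ * ‖WithLp.toLp 2 v‖) ^ 2 := by
    rw [mul_pow]; exact_mod_cast h1
  exact (sq_eq_sq₀ (norm_nonneg _) (by positivity)).1 h3

lemma diffContOnCl_ratio (Q : Matrix m m ℂ[X]) (q : ℂ[X])
    (hq : ∀ z : ℂ, ‖z‖ ≤ 1 → q.eval z ≠ 0) (v : m → ℂ) :
    DiffContOnCl ℂ (fun z => (q.eval z)⁻¹ • WithLp.toLp 2 (evalM z Q *ᵥ v)) (Metric.ball 0 1) := by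
  refine DifferentiableOn.diffContOnCl ?_
  rw [closure_ball _ one_ne_zero, differentiableOn_euclidean]
  intro i z hz
  refine DifferentiableAt.differentiableWithinAt ?_
  have hz' : q.eval z ≠ 0 := hq z (by simpa using hz)
  simp only [PiLp.smul_apply, Matrix.mulVec, dotProduct, smul_eq_mul, evalM_apply]
  refine DifferentiableAt.mul (q.differentiable.differentiableAt.inv hz') ?_
  exact DifferentiableAt.fun_sum fun j _ =>
    ((Q i j).differentiable.differentiableAt.mul_const _)

/-- Maximum principle: `Q / q` is isometric on the circle and has no poles in the closed disc. -/
lemma norm_ratio_le [DecidableEq m] (Q : Matrix m m ℂ[X]) (q : ℂ[X])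
    (hq : ∀ z : ℂ, ‖z‖ ≤ 1 → q.eval z ≠ 0)
    (hQ : ∀ z : ℂ, ‖z‖ = 1 → (evalM z Q)ᴴ * evalM z Q =
      (starRingEnd ℂ (q.eval z) * q.eval z) • (1 : Matrix m m ℂ)) (v : m → ℂ) {z : ℂ}
    (hz : ‖z‖ ≤ 1) :
    ‖(q.eval z)⁻¹ • WithLp.toLp 2 (evalM z Q *ᵥ v)‖ ≤ ‖WithLp.toLp 2 v‖ := by
  refine Complex.norm_le_of_forall_mem_frontier_norm_le (U := Metric.ball (0 : ℂ) 1)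
    Metric.isBounded_ball
    (diffContOnCl_ratio Q q hq v) (fun w hw => ?_) ?_
  · rw [frontier_ball _ one_ne_zero] at hw
    have hw' : ‖w‖ = 1 := by simpa using hw
    have hne : ‖q.eval w‖ ≠ 0 := norm_ne_zero_iff.2 (hq w hw'.le)
    rw [norm_smul, norm_inv, norm_toLp_mulVec_of_gram (hQ w hw'), ← mul_assoc,
      inv_mul_cancel₀ hne, one_mul]
  · rw [closure_ball _ one_ne_zero]; simpa using hz

/-- A rational inner function of one variable whose determinant has no zeros is constant. -/
lemma gram_of_discRoots_eq_zero [DecidableEq m] (Q : Matrix m m ℂ[X]) (q : ℂ[X])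
    (hq : ∀ z : ℂ, ‖z‖ ≤ 1 → q.eval z ≠ 0)
    (hQ : ∀ z : ℂ, ‖z‖ = 1 → (evalM z Q)ᴴ * evalM z Q =
      (starRingEnd ℂ (q.eval z) * q.eval z) • (1 : Matrix m m ℂ))
    (hd : ∀ z : ℂ, ‖z‖ < 1 → Q.det.eval z ≠ 0) (w z : ℂ) :
    (evalM w Q)ᴴ * evalM z Q = (starRingEnd ℂ (q.eval w) * q.eval z) • (1 : Matrix m m ℂ) := by
  have hd' : ∀ z : ℂ, ‖z‖ ≤ 1 → Q.det.eval z ≠ 0 := by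
    intro z hz
    rcases hz.lt_or_eq with h | h
    · exact hd z h
    · intro h0
      have h1 := congrArg Matrix.det (hQ z h)
      rw [Matrix.det_mul, det_evalM, h0, mul_zero, Matrix.det_smul, Matrix.det_one, mul_one] at h1
      have h2 := hq z hz
      exact pow_ne_zero _ (mul_ne_zero ((_root_.map_ne_zero _).2 h2) h2) h1.symm
  -- The inverse `q adj(Q) / det Q` is also pole-free and unitary on the circle, so the maximum
  -- principle bounds it as well.
  have hadj : ∀ z : ℂ, ‖z‖ = 1 → (evalM z (q • Q.adjugate))ᴴ * evalM z (q • Q.adjugate) =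
      (starRingEnd ℂ (Q.det.eval z) * Q.det.eval z) • (1 : Matrix m m ℂ) := by
    intro z hz
    have h1 : evalM z Q * evalM z Q.adjugate = Q.det.eval z • (1 : Matrix m m ℂ) := by
      rw [← adjugate_evalM, Matrix.mul_adjugate, det_evalM]
    have h2 : (evalM z Q.adjugate)ᴴ * ((evalM z Q)ᴴ * evalM z Q) * evalM z Q.adjugate =
        (starRingEnd ℂ (Q.det.eval z) * Q.det.eval z) • (1 : Matrix m m ℂ) := by
      rw [← Matrix.mul_assoc, ← Matrix.conjTranspose_mul, Matrix.mul_assoc, h1,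
        Matrix.conjTranspose_smul, Matrix.smul_mul, Matrix.mul_smul]
      simp [smul_smul]
    rw [← h2, hQ z hz, evalM_smul, Matrix.conjTranspose_smul]
    simp [smul_smul, mul_comm]
  let W : Matrix m m ℂ := (q.eval 0)⁻¹ • evalM 0 Q
  -- With `f = Q / q`, contractivity of `f` and of `f⁻¹` gives `‖f y v‖ ≤ ‖v‖ ≤ ‖f 0 v‖`. The norm
  -- is therefore maximal at the interior point `0`, and strict convexity of the Euclidean norm
  -- makes `f v` itself constant.
  have hconst : ∀ z : ℂ, ‖z‖ < 1 → ∀ v : m → ℂ,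
      (q.eval z)⁻¹ • WithLp.toLp 2 (evalM z Q *ᵥ v) =
        (q.eval 0)⁻¹ • WithLp.toLp 2 (evalM 0 Q *ᵥ v) := by
    intro z hz v
    refine Complex.eqOn_of_isPreconnected_of_isMaxOn_norm (U := Metric.ball (0 : ℂ) 1)
      (f := fun z => (q.eval z)⁻¹ • WithLp.toLp 2 (evalM z Q *ᵥ v)) (c := 0)
      (Metric.isPreconnected_ball) Metric.isOpen_ball
      (diffContOnCl_ratio Q q hq v).differentiableOn (by simp) ?_
      (show z ∈ Metric.ball (0 : ℂ) 1 by simpa using hz)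
    intro y hy
    have hy' : ‖y‖ ≤ 1 := by have : ‖y‖ < 1 := by simpa using hy
                             exact this.le
    refine (norm_ratio_le Q q hq hQ v hy').trans ?_
    have h1 := norm_ratio_le _ _ hd' hadj (W *ᵥ v) (z := 0) (by simp)
    have h2 : (Q.det.eval 0)⁻¹ • WithLp.toLp 2 (evalM 0 (q • Q.adjugate) *ᵥ (W *ᵥ v)) =
        WithLp.toLp 2 v := by
      have h3 : evalM 0 (q • Q.adjugate) * W = Q.det.eval 0 • (1 : Matrix m m ℂ) := by
        rw [evalM_smul, ← adjugate_evalM, Matrix.smul_mul, Matrix.mul_smul, smul_smul,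
          mul_inv_cancel₀ (hq 0 (by simp)), one_smul, Matrix.adjugate_mul, det_evalM]
      rw [Matrix.mulVec_mulVec, h3, Matrix.smul_mulVec, Matrix.one_mulVec, WithLp.toLp_smul,
        smul_smul, inv_mul_cancel₀ (hd' 0 (by simp)), one_smul]
    rw [h2] at h1
    refine h1.trans (le_of_eq ?_)
    simp only [W, Matrix.smul_mulVec, WithLp.toLp_smul, Function.comp]
  have hQW : Q = q • W.map C := by
    ext1 i j
    refine poly_eq_of_disc fun z hz => ?_
    have h1 := congrArg (fun v : EuclideanSpace ℂ m => v i) (hconst z hz (Pi.single j 1))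
    simp only [Matrix.mulVec_single_one, PiLp.smul_apply, Matrix.col_apply, evalM_apply,
      smul_eq_mul] at h1
    simp only [W, Matrix.smul_apply, Matrix.map_apply, evalM_apply, smul_eq_mul, eval_mul, eval_C,
      ← h1]
    rw [mul_inv_cancel_left₀ (hq z hz.le)]
  have hW : Wᴴ * W = 1 := by
    have h1 := hQ 1 (by simp)
    rw [hQW, evalM_smul, evalM_map_C, Matrix.conjTranspose_smul, Matrix.smul_mul, Matrix.mul_smul,
      smul_smul] at h1
    have h2 := hq 1 (by simp)
    exact smul_right_injective _ (mul_ne_zero ((_root_.map_ne_zero (starRingEnd ℂ)).2 h2) h2) h1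
  rw [hQW, evalM_smul, evalM_smul, evalM_map_C, evalM_map_C, Matrix.conjTranspose_smul,
    Matrix.smul_mul, Matrix.mul_smul, hW, smul_smul]
  rfl

/-- The kernel of a rational inner function of one variable is a sum of squares, with as many
squares as the determinant has zeros in the disc. -/
theorem exists_kernel [DecidableEq m] (Q : Matrix m m ℂ[X]) (q : ℂ[X])
    (hq : ∀ z : ℂ, ‖z‖ ≤ 1 → q.eval z ≠ 0)
    (hQ : ∀ z : ℂ, ‖z‖ = 1 → (evalM z Q)ᴴ * evalM z Q =
      (starRingEnd ℂ (q.eval z) * q.eval z) • (1 : Matrix m m ℂ)) (hd : Q.det ≠ 0) :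
    ∃ F : Matrix (Fin (discRoots Q.det)) m ℂ[X], ∀ w z : ℂ,
      (starRingEnd ℂ (q.eval w) * q.eval z) • (1 : Matrix m m ℂ) - (evalM w Q)ᴴ * evalM z Q =
        (1 - z * starRingEnd ℂ w) • ((evalM w F)ᴴ * evalM z F) := by
  induction hn : discRoots Q.det generalizing Q with
  | zero =>
    refine ⟨0, fun w z => ?_⟩
    rw [gram_of_discRoots_eq_zero Q q hq hQ ((discRoots_eq_zero_iff hd).1 hn)]
    ext i j
    simp
  | succ n ih =>
    have hex : ∃ a : ℂ, ‖a‖ < 1 ∧ Q.det.eval a = 0 := by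
      by_contra hcon
      push Not at hcon
      rw [(discRoots_eq_zero_iff hd).2 hcon] at hn
      omega
    obtain ⟨a, ha, ha0⟩ := hex
    rw [← det_evalM] at ha0
    obtain ⟨v, hv, hv0⟩ := Matrix.exists_vecMul_eq_zero_iff.2 ha0
    obtain ⟨u, hu, h0⟩ := exists_unit_left_null hv hv0
    obtain ⟨E', R, hE, hdet⟩ := exists_extraction Q u hu h0
    have hdet1 := hdet 1
    rw [Matrix.mul_one, Matrix.mul_one] at hdet1
    obtain ⟨hne, hcount⟩ := discRoots_extraction ha hd hdet1
    have hQ' : ∀ z : ℂ, ‖z‖ = 1 → (evalM z E')ᴴ * evalM z E' =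
        (starRingEnd ℂ (q.eval z) * q.eval z) • (1 : Matrix m m ℂ) := by
      intro x hx
      rw [← hQ x hx]
      ext j l
      have := hE x x j l
      rw [mul_comm x, conj_mul_self_of_norm hx, sub_self, zero_mul, zero_mul, sub_eq_zero] at this
      exact this
    obtain ⟨F, hF⟩ := ih E' hQ' hne (by omega)
    have hs : 0 ≤ 1 - ‖a‖ ^ 2 := by nlinarith [norm_nonneg a]
    set s : ℝ := Real.sqrt (1 - ‖a‖ ^ 2) with hsdef
    have hss : (s : ℂ) * s = 1 - starRingEnd ℂ a * a := by
      rw [← Complex.ofReal_mul, Real.mul_self_sqrt hs, Complex.conj_mul']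
      push_cast; ring
    -- Undoing one extraction costs exactly one square, with weight `1 - |a|²` as in the kernel of a
    -- single Blaschke factor.
    refine ⟨consRow (fun j => C (s : ℂ) * R j) F, fun w z => ?_⟩
    ext j l
    have h1 := congrFun (congrFun (hF w z) j) l
    have h2 := hE w z j l
    simp only [Matrix.sub_apply, Matrix.smul_apply, smul_eq_mul] at h1 ⊢
    have h3 : ((evalM w (consRow (fun j => C (s : ℂ) * R j) F))ᴴ *
        evalM z (consRow (fun j => C (s : ℂ) * R j) F)) j l =
        (s : ℂ) * s * (starRingEnd ℂ ((R j).eval w) * (R l).eval z) +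
          ((evalM w F)ᴴ * evalM z F) j l := by
      rw [Matrix.mul_apply, Fin.sum_univ_succ, Matrix.mul_apply]
      congr 1
      simp [Matrix.conjTranspose_apply]
      ring
    rw [h3, hss]
    linear_combination h1 + h2

end OneVariable

/-! ### Trigonometric polynomials and Fejér–Riesz factorization -/

section Trig

lemma mem_of_continuousAt {Y : Type*} [TopologicalSpace Y] {s : Set Y} (hs : IsClosed s)
    {f : ℂ → Y} (h : ∀ᶠ x in circleGen, f x ∈ s) {x : ℂ} (hx : ‖x‖ = 1)
    (hf : ContinuousAt f x) : f x ∈ s := by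
  have := nhdsWithin_circle_neBot hx
  exact hs.mem_of_tendsto (hf.tendsto.mono_left (inf_le_left.trans nhdsWithin_le_nhds))
    (h.filter_mono (nhdsWithin_circle_le x))

/-- Reversing `P` and conjugating its coefficients realizes the reflection in the circle. -/
lemma exists_conj_reflection (P : ℂ[X]) : ∃ R : ℂ[X], ∀ x : ℂ, x ≠ 0 →
    R.eval x = x ^ P.natDegree * starRingEnd ℂ (P.eval (starRingEnd ℂ x)⁻¹) := by
  refine ⟨(P.map (starRingEnd ℂ)).reverse, fun x hx => ?_⟩
  have : Invertible x⁻¹ := invertibleOfNonzero (inv_ne_zero hx)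
  have h := eval₂_reverse_mul_pow (RingHom.id ℂ) x⁻¹ (P.map (starRingEnd ℂ))
  rw [invOf_eq_inv, inv_inv, ← eval, ← eval, natDegree_map] at h
  have h2 : eval x⁻¹ (P.map (starRingEnd ℂ)) = starRingEnd ℂ (P.eval (starRingEnd ℂ x)⁻¹) := by
    have := Polynomial.eval_map_apply (starRingEnd ℂ) ((starRingEnd ℂ x)⁻¹) (p := P)
    rw [← this]
    simp
  rw [h2] at h
  rw [← h, inv_pow]
  field_simp

/-- Restriction to the circle of a trigonometric polynomial. -/
def IsTrig (f : ℂ → ℂ) : Prop :=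
  ∃ (L : ℕ) (P : ℂ[X]), ∀ x : ℂ, ‖x‖ = 1 → x ^ L * f x = P.eval x

lemma conj_inv_of_norm {x : ℂ} (hx : ‖x‖ = 1) : (starRingEnd ℂ x)⁻¹ = x :=
  inv_eq_of_mul_eq_one_right (conj_mul_self_of_norm hx)

lemma isTrig_poly (P : ℂ[X]) : IsTrig fun x => P.eval x := ⟨0, P, fun x _ => by simp⟩

lemma isTrig_conj_poly (P : ℂ[X]) : IsTrig fun x => starRingEnd ℂ (P.eval x) := by
  obtain ⟨R, hR⟩ := exists_conj_reflection P
  refine ⟨P.natDegree, R, fun x hx => ?_⟩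
  rw [hR x (ne_zero_of_norm_one hx), conj_inv_of_norm hx]

lemma IsTrig.add {f g : ℂ → ℂ} (hf : IsTrig f) (hg : IsTrig g) : IsTrig fun x => f x + g x := by
  obtain ⟨L, P, hP⟩ := hf
  obtain ⟨M, R, hR⟩ := hg
  refine ⟨L + M, X ^ M * P + X ^ L * R, fun x hx => ?_⟩
  simp only [eval_add, eval_mul, eval_pow, eval_X, ← hP x hx, ← hR x hx]
  ring

lemma IsTrig.mul {f g : ℂ → ℂ} (hf : IsTrig f) (hg : IsTrig g) : IsTrig fun x => f x * g x := by
  obtain ⟨L, P, hP⟩ := hf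
  obtain ⟨M, R, hR⟩ := hg
  refine ⟨L + M, P * R, fun x hx => ?_⟩
  simp only [eval_mul, ← hP x hx, ← hR x hx]
  ring

lemma IsTrig.sub {f g : ℂ → ℂ} (hf : IsTrig f) (hg : IsTrig g) : IsTrig fun x => f x - g x := by
  have := hf.add ((isTrig_poly (C (-1))).mul hg)
  simpa [sub_eq_add_neg] using this

lemma isTrig_sum {ι : Type*} (s : Finset ι) {f : ι → ℂ → ℂ} (h : ∀ i ∈ s, IsTrig (f i)) :
    IsTrig fun x => ∑ i ∈ s, f i x := by
  classical
  induction s using Finset.induction_on with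
  | empty => simpa using isTrig_poly 0
  | insert a s ha ih =>
    simp only [Finset.sum_insert ha]
    exact (h a (Finset.mem_insert_self _ _)).add
      (ih fun i hi => h i (Finset.mem_insert_of_mem hi))

lemma exists_common_trig {κ : Type*} [Fintype κ] {f : κ → ℂ → ℂ} (h : ∀ j, IsTrig (f j)) :
    ∃ (L : ℕ) (P : κ → ℂ[X]), ∀ j (x : ℂ), ‖x‖ = 1 → x ^ L * f j x = (P j).eval x := by
  choose L P hP using h
  refine ⟨Finset.univ.sup L, fun j => X ^ (Finset.univ.sup L - L j) * P j, fun j x hx => ?_⟩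
  rw [eval_mul, eval_pow, eval_X, ← hP j x hx, ← mul_assoc, ← pow_add,
    Nat.sub_add_cancel (Finset.le_sup (Finset.mem_univ j))]

lemma IsTrig.eventually_ne_zero {f : ℂ → ℂ} (hf : IsTrig f) {y : ℂ} (hy : ‖y‖ = 1)
    (h : f y ≠ 0) : ∀ᶠ x in circleGen, f x ≠ 0 := by
  obtain ⟨L, P, hP⟩ := hf
  have hP0 : P ≠ 0 := by
    rintro rfl
    have := hP y hy
    rw [eval_zero] at this
    exact mul_ne_zero (pow_ne_zero _ (ne_zero_of_norm_one hy)) h this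
  filter_upwards [eventually_eval_ne_zero hP0, eventually_circle] with x hx hx1 h0
  rw [← hP x hx1, h0, mul_zero] at hx
  exact hx rfl

/-- Test `x = 1` and `x = exp (π i / L)`, where `x ^ L` takes the values `1` and `-1`. -/
lemma eq_zero_of_zpow_nonneg {c : ℂ} {L : ℤ} (hL : L ≠ 0)
    (h : ∀ x : ℂ, ‖x‖ = 1 → 0 ≤ x ^ L * c) : c = 0 := by
  have h1 : 0 ≤ c := by simpa using h 1 (by simp)
  have h2 : 0 ≤ -c := by
    have hx : ‖Complex.exp (((Real.pi / L : ℝ) : ℂ) * Complex.I)‖ = 1 :=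
      Complex.norm_exp_ofReal_mul_I _
    have := h _ hx
    rw [← Complex.exp_int_mul, show (L : ℂ) * (((Real.pi / L : ℝ) : ℂ) * Complex.I) =
      Real.pi * Complex.I by
        push_cast
        have : (L : ℂ) ≠ 0 := by exact_mod_cast hL
        field_simp, Complex.exp_pi_mul_I] at this
    simpa using this
  exact le_antisymm (neg_nonneg.1 h2) h1

/-- A nonnegative function on the circle has a minimum at each of its zeros, so its derivative in
the angle vanishes there; at `a` that derivative is a nonzero multiple of `P.eval a`. -/
lemma eval_eq_zero_of_simple_zero {P : ℂ[X]} {L : ℤ} {a : ℂ} (ha : ‖a‖ = 1)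
    (h : ∀ x : ℂ, ‖x‖ = 1 → 0 ≤ x ^ L * ((x - a) * P.eval x)) : P.eval a = 0 := by
  have ha0 := ne_zero_of_norm_one ha
  let e : ℝ → ℂ := fun θ => a * Complex.exp (θ * Complex.I)
  have he0 : e 0 = a := by simp [e]
  have hen : ∀ θ, ‖e θ‖ = 1 := fun θ => by
    simp only [e, norm_mul, ha, Complex.norm_exp_ofReal_mul_I, one_mul]
  have hed : HasDerivAt e (a * Complex.I) 0 := by
    have h1 : HasDerivAt (fun θ : ℝ => (θ : ℂ) * Complex.I) (1 * Complex.I) 0 :=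
      (Complex.ofRealCLM.hasDerivAt (x := (0 : ℝ))).mul_const Complex.I
    have h2 := (h1.cexp).const_mul a
    simpa using h2
  have hu : DifferentiableAt ℝ (fun θ => e θ ^ L * P.eval (e θ)) 0 := by
    have h1 : DifferentiableAt ℂ (fun x : ℂ => x ^ L * P.eval x) (e 0) := by
      rw [he0]
      exact (differentiableAt_zpow.2 (Or.inl ha0)).mul P.differentiable.differentiableAt
    exact (h1.restrictScalars ℝ).comp (0 : ℝ) hed.differentiableAt
  have hd := (hed.sub_const a).mul hu.hasDerivAt
  simp only [he0, sub_self, zero_mul, add_zero] at hd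
  set d := a * Complex.I * (a ^ L * P.eval a) with hddef
  have hnn : ∀ θ, 0 ≤ ((fun θ => e θ - a) * fun θ => e θ ^ L * P.eval (e θ)) θ := by
    intro θ
    have := h _ (hen θ)
    rw [show ((fun θ => e θ - a) * fun θ => e θ ^ L * P.eval (e θ)) θ =
      e θ ^ L * ((e θ - a) * P.eval (e θ)) by simp only [Pi.mul_apply]; ring]
    exact this
  have hre := Complex.reCLM.hasFDerivAt.comp_hasDerivAt (0 : ℝ) hd
  have him := Complex.imCLM.hasFDerivAt.comp_hasDerivAt (0 : ℝ) hd
  have h1 : d.re = 0 := by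
    refine IsLocalMin.hasDerivAt_eq_zero (Filter.Eventually.of_forall fun θ => ?_) hre
    have := (Complex.le_def.1 (hnn θ)).1
    simpa [he0] using this
  have h2 : d.im = 0 := by
    refine him.unique ?_
    have : (⇑Complex.imCLM ∘ ((fun θ => e θ - a) * fun θ => e θ ^ L * P.eval (e θ))) =
        fun _ => (0 : ℝ) := by
      funext θ
      exact (Complex.le_def.1 (hnn θ)).2.symm
    rw [this]
    exact hasDerivAt_const _ _
  have h3 : d = 0 := Complex.ext h1 h2
  rw [hddef] at h3
  simpa [ha0, zpow_ne_zero] using h3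

/-- Being real on the circle makes the Laurent polynomial symmetric under `x ↦ 1 / conj x`, so its
nonzero roots are permuted by this reflection. -/
lemma eval_reflected_eq_zero {P : ℂ[X]} {L : ℤ} {a : ℂ} (ha : a ≠ 0) (hPa : P.eval a = 0)
    (h : ∀ x : ℂ, ‖x‖ = 1 → 0 ≤ x ^ L * P.eval x) : P.eval (starRingEnd ℂ a)⁻¹ = 0 := by
  obtain ⟨R, hR⟩ := exists_conj_reflection P
  -- Splitting `L = L.toNat - (-L).toNat` clears negative powers from the symmetry.
  have hid : X ^ (P.natDegree + 2 * L.toNat) * P = X ^ (2 * (-L).toNat) * R := by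
    refine poly_eq_of_eventually (eventually_of_circle fun x hx => ?_)
    have hx0 := ne_zero_of_norm_one hx
    have h1 : starRingEnd ℂ (x ^ L * P.eval x) = x ^ L * P.eval x :=
      Complex.conj_eq_iff_im.2 (Complex.le_def.1 (h x hx)).2.symm
    have h2 : starRingEnd ℂ x = x⁻¹ := eq_inv_of_mul_eq_one_left (conj_mul_self_of_norm hx)
    rw [map_mul, map_zpow₀, h2, inv_zpow] at h1
    have h3 : x ^ L * x ^ (-L).toNat = x ^ L.toNat := by
      rw [← zpow_natCast, ← zpow_natCast, ← zpow_add₀ hx0]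
      congr 1; omega
    simp only [eval_mul, eval_pow, eval_X, hR x hx0, conj_inv_of_norm hx]
    have hz : x ^ L ≠ 0 := zpow_ne_zero _ hx0
    rw [inv_mul_eq_iff_eq_mul₀ hz] at h1
    rw [h1, pow_add, pow_mul', pow_mul', ← h3]
    ring
  set b := (starRingEnd ℂ a)⁻¹ with hb
  have hb0 : b ≠ 0 := inv_ne_zero ((_root_.map_ne_zero _).2 ha)
  have h1 := congrArg (eval b) hid
  have h2 : (starRingEnd ℂ b)⁻¹ = a := by simp [hb]
  simp only [eval_mul, eval_pow, eval_X, hR b hb0, h2, hPa, map_zero, mul_zero] at h1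
  exact (mul_eq_zero.1 h1).resolve_left (pow_ne_zero _ hb0)

/-- The scalar Fejér–Riesz theorem. -/
theorem fejer_riesz (P : ℂ[X]) (L : ℤ) (h : ∀ x : ℂ, ‖x‖ = 1 → 0 ≤ x ^ L * P.eval x) :
    ∃ a : ℂ[X], ∀ x : ℂ, ‖x‖ = 1 → x ^ L * P.eval x = starRingEnd ℂ (a.eval x) * a.eval x := by
  induction hn : P.natDegree using Nat.strong_induction_on generalizing P L with
  | _ d ih =>
  by_cases hP : P = 0
  · exact ⟨0, fun x _ => by simp [hP]⟩
  by_cases hd : P.natDegree = 0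
  · obtain ⟨c, rfl⟩ := natDegree_eq_zero.1 hd
    simp only [eval_C] at h ⊢
    by_cases hL : L = 0
    · subst hL
      have hc : 0 ≤ c := by simpa using h 1 (by simp)
      refine ⟨C ((Real.sqrt c.re : ℝ) : ℂ), fun x _ => ?_⟩
      rw [eval_C, Complex.conj_ofReal, ← Complex.ofReal_mul,
        Real.mul_self_sqrt (Complex.le_def.1 hc).1, zpow_zero, one_mul]
      exact Complex.ext rfl (Complex.le_def.1 hc).2.symm
    · exact ⟨0, fun x _ => by simp [eq_zero_of_zpow_nonneg hL h]⟩
  obtain ⟨a, ha⟩ := Complex.exists_root (f := P)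
    (natDegree_pos_iff_degree_pos.1 (Nat.pos_of_ne_zero hd))
  obtain ⟨P₁, rfl⟩ := dvd_iff_isRoot.2 ha
  have hP₁ : P₁ ≠ 0 := right_ne_zero_of_mul hP
  have hdeg : P₁.natDegree < d := by
    rw [← hn, natDegree_mul (X_sub_C_ne_zero a) hP₁, natDegree_X_sub_C]; omega
  by_cases ha0 : a = 0
  · subst ha0
    have hf : ∀ x : ℂ, ‖x‖ = 1 → x ^ (L + 1) * P₁.eval x = x ^ L * eval x ((X - C 0) * P₁) := by
      intro x hx
      rw [zpow_add_one₀ (ne_zero_of_norm_one hx)]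
      simp; ring
    obtain ⟨b, hb⟩ := ih _ hdeg P₁ (L + 1) (fun x hx => by rw [hf x hx]; exact h x hx) rfl
    exact ⟨b, fun x hx => by rw [← hf x hx]; exact hb x hx⟩
  have ha0' : starRingEnd ℂ a ≠ 0 := (_root_.map_ne_zero _).2 ha0
  -- Nonzero roots come in reflected pairs; on the circle, where a root is its own reflection, the
  -- pair is a double root.
  have hroot : P₁.eval (starRingEnd ℂ a)⁻¹ = 0 := by
    by_cases han : ‖a‖ = 1
    · rw [conj_inv_of_norm han]
      exact eval_eq_zero_of_simple_zero (L := L) han (fun x hx => by simpa using h x hx)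
    · have h1 := eval_reflected_eq_zero ha0 ha h
      rw [eval_mul] at h1
      refine (mul_eq_zero.1 h1).resolve_left ?_
      simp only [eval_sub, eval_X, eval_C]
      intro h2
      have h3 : starRingEnd ℂ a * a = 1 := by
        have h3 := mul_inv_cancel₀ ha0'
        rwa [sub_eq_zero.1 h2] at h3
      rw [Complex.conj_mul'] at h3
      have h4 : ‖a‖ ^ 2 = 1 := by exact_mod_cast h3
      exact han ((pow_eq_one_iff_of_nonneg (norm_nonneg a) two_ne_zero).1 h4)
  obtain ⟨P₂, rfl⟩ := dvd_iff_isRoot.2 hroot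
  have hP₂ : P₂ ≠ 0 := right_ne_zero_of_mul hP₁
  -- On the circle a reflected pair of linear factors equals `|x - a|²` times `-x / conj a`, and the
  -- last quantity is absorbed into the cofactor and the exponent.
  have hf : ∀ x : ℂ, ‖x‖ = 1 → x ^ L * eval x ((X - C a) * ((X - C (starRingEnd ℂ a)⁻¹) * P₂)) =
      (starRingEnd ℂ (x - a) * (x - a)) *
        (x ^ (L + 1) * (C (-(starRingEnd ℂ a)⁻¹) * P₂).eval x) := by
    intro x hx
    rw [zpow_add_one₀ (ne_zero_of_norm_one hx)]
    have h2 : starRingEnd ℂ x = x⁻¹ := eq_inv_of_mul_eq_one_left (conj_mul_self_of_norm hx)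
    simp only [eval_mul, eval_sub, eval_X, eval_C, map_sub, h2]
    have := ne_zero_of_norm_one hx
    field_simp
    ring
  -- Divide by `|x - a|²` away from `a`, and use continuity at `a` if it lies on the circle.
  have hnn : ∀ x : ℂ, ‖x‖ = 1 → 0 ≤ x ^ (L + 1) * (C (-(starRingEnd ℂ a)⁻¹) * P₂).eval x := by
    intro x hx
    refine mem_of_continuousAt (s := Set.Ici (0 : ℂ)) isClosed_Ici ?_ hx
      (f := fun x => x ^ (L + 1) * (C (-(starRingEnd ℂ a)⁻¹) * P₂).eval x) ?_
    · filter_upwards [eventually_circle, eventually_eval_ne_zero (X_sub_C_ne_zero a)] with y hy hya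
      have h1 := h y hy
      rw [hf y hy, Complex.conj_mul'] at h1
      have h2 : y - a ≠ 0 := by simpa using hya
      have h3 : 0 < ‖y - a‖ ^ 2 := by have := norm_pos_iff.2 h2; positivity
      rw [← Complex.ofReal_pow, Complex.le_def, Complex.re_ofReal_mul, Complex.im_ofReal_mul] at h1
      refine Complex.le_def.2 ⟨(mul_nonneg_iff_of_pos_left h3).1 h1.1, ?_⟩
      have h4 : 0 = ‖y - a‖ ^ 2 * _ := h1.2
      exact ((mul_eq_zero.1 h4.symm).resolve_left h3.ne').symm
    · exact (continuousAt_zpow₀ _ _ (Or.inl (ne_zero_of_norm_one hx))).mul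
        (Polynomial.continuous _).continuousAt
  have hdeg2 : (C (-(starRingEnd ℂ a)⁻¹) * P₂).natDegree < d := by
    refine lt_of_le_of_lt ((natDegree_C_mul_le _ _).trans ?_) hdeg
    rw [natDegree_mul (X_sub_C_ne_zero _) hP₂]; omega
  obtain ⟨b, hb⟩ := ih _ hdeg2 _ (L + 1) hnn rfl
  refine ⟨(X - C a) * b, fun x hx => ?_⟩
  rw [hf x hx, hb x hx]
  simp only [eval_mul, eval_sub, eval_X, eval_C, map_mul]
  ring

lemma IsTrig.exists_norm_sq {f : ℂ → ℂ} (hf : IsTrig f) (h : ∀ x : ℂ, ‖x‖ = 1 → 0 ≤ f x) :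
    ∃ a : ℂ[X], ∀ x : ℂ, ‖x‖ = 1 → f x = starRingEnd ℂ (a.eval x) * a.eval x := by
  obtain ⟨L, P, hP⟩ := hf
  have h1 : ∀ x : ℂ, ‖x‖ = 1 → x ^ (-(L : ℤ)) * P.eval x = f x := by
    intro x hx
    rw [← hP x hx, zpow_neg, zpow_natCast, inv_mul_cancel_left₀]
    exact pow_ne_zero _ (ne_zero_of_norm_one hx)
  obtain ⟨a, ha⟩ := fejer_riesz P (-L) (fun x hx => by rw [h1 x hx]; exact h x hx)
  exact ⟨a, fun x hx => by rw [← h1 x hx]; exact ha x hx⟩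

/-- A factorization of positive semidefinite matrices of trigonometric polynomials. -/
theorem exists_factorization {κ : Type*} [Fintype κ] [DecidableEq κ] (S : Finset κ)
    (T : ℂ → Matrix κ κ ℂ) (htrig : ∀ i j, IsTrig fun x => T x i j)
    (hpsd : ∀ x : ℂ, ‖x‖ = 1 → (T x).PosSemidef)
    (hS : ∀ i ∉ S, ∀ x : ℂ, ‖x‖ = 1 → T x i i = 0) :
    ∃ (r : ℕ) (E : Matrix (Fin r) κ ℂ[X]) (c : ℂ[X]), c ≠ 0 ∧
      (∀ x : ℂ, ‖x‖ = 1 →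
        (evalM x E)ᴴ * evalM x E = (starRingEnd ℂ (c.eval x) * c.eval x) • T x) ∧
      ∀ᶠ x in circleGen, ∀ v, v ᵥ* evalM x E = 0 → v = 0 := by
  induction S using Finset.induction_on generalizing T with
  | empty =>
    refine ⟨0, 0, 1, one_ne_zero, fun x hx => ?_, Eventually.of_forall fun x v _ =>
      Subsingleton.elim _ _⟩
    have h0 : T x = 0 := by
      rw [← (hpsd x hx).trace_eq_zero_iff, Matrix.trace]
      exact Finset.sum_eq_zero fun i _ => hS i (Finset.notMem_empty i) x hx
    ext i j
    simp [h0, Matrix.mul_apply]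
  | insert i S hi ih =>
    by_cases hz : ∀ x : ℂ, ‖x‖ = 1 → T x i i = 0
    · refine ih T htrig hpsd fun j hj x hx => ?_
      by_cases hji : j = i
      · subst hji; exact hz x hx
      · exact hS j (by simp [hji, hj]) x hx
    push Not at hz
    obtain ⟨y, hy, hty⟩ := hz
    have hgen := (htrig i i).eventually_ne_zero hy hty
    obtain ⟨a, ha⟩ := (htrig i i).exists_norm_sq fun x hx => (hpsd x hx).diag_nonneg
    have ha0 : a ≠ 0 := by
      rintro rfl
      rw [ha y hy] at hty
      simp at hty
    have hherm : ∀ x : ℂ, ‖x‖ = 1 → ∀ j l, starRingEnd ℂ (T x j l) = T x l j :=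
      fun x hx j l => (hpsd x hx).isHermitian.apply l j
    -- Gaussian elimination with pivot `T i i`: a Schur complement cleared of denominators. It kills
    -- row and column `i`. The extra factor `T x i i` makes it a congruence `Bᴴ T B`, hence positive
    -- semidefinite.
    let T' : ℂ → Matrix κ κ ℂ := fun x => Matrix.of fun j l =>
      T x i i * (T x i i * T x j l - T x j i * T x i l)
    have hT'psd : ∀ x : ℂ, ‖x‖ = 1 → (T' x).PosSemidef := by
      intro x hx
      let B : Matrix κ κ ℂ := Matrix.of fun j l =>
        (if j = l then T x i i else 0) - if j = i then T x i l else 0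
      have hB : T' x = Bᴴ * T x * B := by
        have h1 : T x * B = Matrix.of fun j l => T x i i * T x j l - T x j i * T x i l := by
          ext j l
          simp [B, Matrix.mul_apply, mul_sub, Finset.sum_sub_distrib, mul_comm]
        rw [Matrix.mul_assoc, h1]
        ext j l
        simp only [B, Matrix.mul_apply, Matrix.conjTranspose_apply, Matrix.of_apply,
          RCLike.star_def, T', map_sub, apply_ite (starRingEnd ℂ), map_zero, sub_mul, ite_mul,
          zero_mul, Finset.sum_sub_distrib, Finset.sum_ite_eq', Finset.mem_univ, if_true,
          hherm x hx]
        ring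
      rw [hB]
      exact (hpsd x hx).conjTranspose_mul_mul_same B
    have hT'trig : ∀ j l, IsTrig fun x => T' x j l := fun j l =>
      (htrig i i).mul (((htrig i i).mul (htrig j l)).sub ((htrig j i).mul (htrig i l)))
    have hT'i : ∀ x, T' x i i = 0 := fun x => by simp [T']
    -- Where `T j j` already vanished, the new diagonal entry is `-T i i |T i j|²`; positivity
    -- forces it to be zero.
    have hT'S : ∀ j ∉ S, ∀ x : ℂ, ‖x‖ = 1 → T' x j j = 0 := by
      intro j hj x hx
      by_cases hji : j = i
      · subst hji; exact hT'i x
      have h0 := hS j (by simp [hji, hj]) x hx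
      refine le_antisymm ?_ (hT'psd x hx).diag_nonneg
      have h1 : T' x j j = -(T x i i * (starRingEnd ℂ (T x i j) * T x i j)) := by
        simp only [T', Matrix.of_apply, h0, hherm x hx]; ring
      rw [h1, neg_nonpos]
      exact mul_nonneg (hpsd x hx).diag_nonneg (star_mul_self_nonneg _)
    obtain ⟨r, E, c, hc, hE, hEv⟩ := ih T' hT'trig hT'psd hT'S
    obtain ⟨L, P, hP⟩ := exists_common_trig (fun l => htrig i l)
    -- Since `|a|² = T i i` and `|P l| = |T i l|` on the circle, the new row restores the rank-one
    -- term subtracted in `T'`, and `|c a a|²` matches the factor `(T i i)²`.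
    refine ⟨r + 1, consRow (fun l => c * a * P l) E, c * a * a,
      mul_ne_zero (mul_ne_zero hc ha0) ha0, fun x hx => ?_, ?_⟩
    · ext j l
      have h1 := congrFun (congrFun (hE x hx) j) l
      rw [Matrix.mul_apply] at h1
      rw [Matrix.mul_apply, Fin.sum_univ_succ]
      have h2 : ∀ k : Fin r, (evalM x (consRow (fun l => c * a * P l) E))ᴴ j k.succ *
          evalM x (consRow (fun l => c * a * P l) E) k.succ l =
          (evalM x E)ᴴ j k * evalM x E k l := fun k => rfl
      rw [Finset.sum_congr rfl fun k _ => h2 k, h1]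
      simp only [Matrix.conjTranspose_apply, evalM_apply, consRow_zero, RCLike.star_def, eval_mul,
        map_mul, ← hP _ x hx, Matrix.smul_apply, smul_eq_mul, T', Matrix.of_apply, hherm x hx,
        map_pow, ha x hx]
      have h3 : starRingEnd ℂ x ^ L * x ^ L = 1 := by
        rw [← mul_pow, conj_mul_self_of_norm hx, one_pow]
      linear_combination (starRingEnd ℂ (c.eval x) * starRingEnd ℂ (a.eval x) * c.eval x *
        a.eval x * T x j i * T x i l) * h3
    · filter_upwards [hgen, hEv, eventually_eval_ne_zero hc, eventually_eval_ne_zero ha0,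
        eventually_circle] with x h1 h2 h3 h4 hx v hv
      -- The old rows vanish in column `i` while the new row does not, so the new row is independent
      -- of them.
      have hcol : ∀ k, (E k i).eval x = 0 := by
        have h5 := congrFun (congrFun (hE x hx) i) i
        rw [Matrix.smul_apply, hT'i, smul_zero, Matrix.mul_apply] at h5
        have h6 : ∀ k, (evalM x E)ᴴ i k * evalM x E k i = ((‖(E k i).eval x‖ ^ 2 : ℝ) : ℂ) := by
          intro k
          rw [Complex.ofReal_pow, ← Complex.conj_mul']; rfl
        rw [Finset.sum_congr rfl fun k _ => h6 k, ← Complex.ofReal_sum, Complex.ofReal_eq_zero,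
          Finset.sum_eq_zero_iff_of_nonneg fun k _ => by positivity] at h5
        intro k
        simpa using h5 k (Finset.mem_univ _)
      have hv' : ∀ l, v 0 * (c.eval x * a.eval x * (P l).eval x) +
          ∑ k : Fin r, v k.succ * (E k l).eval x = 0 := by
        intro l
        have := congrFun hv l
        simp only [Matrix.vecMul, dotProduct, Fin.sum_univ_succ, evalM_apply, consRow_zero,
          consRow_succ, eval_mul, Pi.zero_apply] at this
        exact this
      have hv0 : v 0 = 0 := by
        have h5 := hv' i
        simp only [hcol, mul_zero, Finset.sum_const_zero, add_zero, ← hP i x hx] at h5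
        refine (mul_eq_zero.1 h5).resolve_right ?_
        exact mul_ne_zero (mul_ne_zero h3 h4)
          (mul_ne_zero (pow_ne_zero _ (ne_zero_of_norm_one hx)) h1)
      have hvs := h2 (fun k => v k.succ) (by
        funext l
        have h5 := hv' l
        rw [hv0, zero_mul, zero_add] at h5
        exact h5)
      funext k
      refine Fin.cases hv0 (fun k => congrFun hvs k) k

end Trig

/-! ### Outer factorization -/

section State

lemma rank_eq_of_vecMul {r : ℕ} {κ : Type*} [Fintype κ] {A : Matrix (Fin r) κ ℂ}
    (h : ∀ v, v ᵥ* A = 0 → v = 0) : A.rank = r := by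
  have h1 : Function.Injective A.vecMul := by
    intro v w hvw
    have := h (v - w) (by rw [Matrix.sub_vecMul]; exact sub_eq_zero.2 hvw)
    exact sub_eq_zero.1 this
  have := (Matrix.vecMul_injective_iff.1 h1).rank_matrix
  simpa using this

lemma det_mul_conjTranspose_ne_zero {ρ κ : Type*} [Fintype ρ] [DecidableEq ρ] [Fintype κ]
    {A : Matrix ρ κ ℂ} (h : ∀ v, v ᵥ* A = 0 → v = 0) : (A * Aᴴ).det ≠ 0 := by
  intro h0
  obtain ⟨v, hv, hv0⟩ := Matrix.exists_vecMul_eq_zero_iff.2 h0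
  exact hv (h v ((Matrix.vecMul_self_mul_conjTranspose_eq_zero A v).1 hv0))

/-- This is `exists_outer` for a one-by-one matrix: zeros in the disc are reflected out of it. -/
lemma exists_zero_free (c : ℂ[X]) (hc : c ≠ 0) :
    ∃ c' : ℂ[X], (∀ x : ℂ, ‖x‖ < 1 → c'.eval x ≠ 0) ∧ ∀ x : ℂ, ‖x‖ = 1 →
      starRingEnd ℂ (c'.eval x) * c'.eval x = starRingEnd ℂ (c.eval x) * c.eval x := by
  obtain ⟨E, h1, h2⟩ := exists_outer (1 : Matrix Unit Unit ℂ[X]) (Matrix.of fun _ _ => c)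
    (by simpa using hc)
  refine ⟨E () (), fun x hx h0 => ?_, fun x hx => ?_⟩
  · have := h2 x hx (fun _ => 1) (by
      funext j
      simp [Matrix.vecMul, dotProduct, h0])
    exact one_ne_zero (congrFun this ())
  · have := congrFun (congrFun (h1 x hx) ()) ()
    simpa [Matrix.mul_apply] using this

/-- The matrix Fejér–Riesz factorization with an outer factor, up to a scalar denominator. -/
theorem exists_outer_factorization {κ : Type*} [Fintype κ] [DecidableEq κ]
    (T : ℂ → Matrix κ κ ℂ) (htrig : ∀ i j, IsTrig fun x => T x i j)
    (hpsd : ∀ x : ℂ, ‖x‖ = 1 → (T x).PosSemidef) :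
    ∃ (r : ℕ) (E : Matrix (Fin r) κ ℂ[X]) (c : ℂ[X]),
      (∀ x : ℂ, ‖x‖ < 1 → c.eval x ≠ 0) ∧
      (∀ x : ℂ, ‖x‖ = 1 →
        (evalM x E)ᴴ * evalM x E = (starRingEnd ℂ (c.eval x) * c.eval x) • T x) ∧
      (∀ x : ℂ, ‖x‖ < 1 → ∀ v, v ᵥ* evalM x E = 0 → v = 0) ∧
      ∀ᶠ x in circleGen, r ≤ (T x).rank := by
  obtain ⟨r, E, c, hc, hE, hv⟩ := exists_factorization Finset.univ T htrig hpsd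
    (fun i hi => absurd (Finset.mem_univ i) hi)
  obtain ⟨x₀, hx₀⟩ := hv.exists
  -- The constant multiplier `E(x₀)ᴴ` makes the determinant nonzero at `x₀`, where the rows of `E`
  -- are independent.
  obtain ⟨E', h1, h2⟩ := exists_outer ((evalM x₀ E)ᴴ.map C) E (by
    intro h0
    apply det_mul_conjTranspose_ne_zero hx₀
    have := congrArg (eval x₀) h0
    rwa [← det_evalM, evalM_mul, evalM_map_C, eval_zero] at this)
  obtain ⟨c', hc', hcc⟩ := exists_zero_free c hc
  refine ⟨r, E', c', hc', fun x hx => by rw [h1 x hx, hE x hx, hcc x hx], h2, ?_⟩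
  filter_upwards [hv, eventually_circle] with x hx hx1
  have h3 := congrArg Matrix.rank (hE x hx1)
  rw [Matrix.rank_conjTranspose_mul_self, rank_eq_of_vecMul hx] at h3
  rw [h3, ← Matrix.one_mul (T x), ← Matrix.smul_mul]
  exact (Matrix.rank_mul_le_right _ _).trans (by rw [Matrix.one_mul])

/-! ### Kernels in one variable with common zeros allowed -/

section Section
variable {m : Type*} [Fintype m] [DecidableEq m]

/-- A variant of `exists_kernel` that allows common zeros of numerator and denominator. -/
theorem exists_kernel_of_le (Q : Matrix m m ℂ[X]) (q gt g : ℂ[X]) (hq : q ≠ 0)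
    (hQ : ∀ z : ℂ, ‖z‖ = 1 → (evalM z Q)ᴴ * evalM z Q =
      (starRingEnd ℂ (q.eval z) * q.eval z) • (1 : Matrix m m ℂ))
    (hle : ∀ z : ℂ, ‖z‖ < 1 → ∀ i j, ‖(Q i j).eval z‖ ≤ ‖q.eval z‖)
    (hg : g ≠ 0) (hgt : gt ≠ 0) (hdet : Q.det * g = gt * q ^ Fintype.card m) :
    ∃ s ≤ gt.natDegree, ∃ F : Matrix (Fin s) m ℂ[X], ∀ w z : ℂ,
      (starRingEnd ℂ (q.eval w) * q.eval z) • (1 : Matrix m m ℂ) - (evalM w Q)ᴴ * evalM z Q =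
        (1 - z * starRingEnd ℂ w) • ((evalM w F)ᴴ * evalM z F) := by
  obtain ⟨Q', q', h, hh, hq', rfl, rfl, hred⟩ := exists_reduced Q q hq
  have hQ' : ∀ z : ℂ, ‖z‖ = 1 → (evalM z Q')ᴴ * evalM z Q' =
      (starRingEnd ℂ (q'.eval z) * q'.eval z) • (1 : Matrix m m ℂ) := by
    intro z hz
    refine eq_of_eventually (f := fun z => (evalM z Q')ᴴ * evalM z Q')
      (g := fun z => (starRingEnd ℂ (q'.eval z) * q'.eval z) • (1 : Matrix m m ℂ)) ?_ ?_ ?_ hz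
    · exact (continuous_evalM Q').matrix_conjTranspose.matrix_mul (continuous_evalM Q')
    · exact ((Complex.continuous_conj.comp q'.continuous).mul q'.continuous).smul continuous_const
    · filter_upwards [eventually_circle, eventually_eval_ne_zero hh] with x hx hx0
      have h1 := hQ x hx
      rw [evalM_smul, Matrix.conjTranspose_smul, Matrix.smul_mul, Matrix.mul_smul, smul_smul,
        eval_mul, map_mul, mul_mul_mul_comm,
        ← smul_smul _ _ (1 : Matrix m m ℂ)] at h1
      exact smul_right_injective _ (mul_ne_zero ((_root_.map_ne_zero (starRingEnd ℂ)).2 hx0) hx0) h1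
  -- At a zero of `q'` the whole matrix `Q'` would vanish: inside the disc by the entrywise bound,
  -- on the circle by the Gram identity. This contradicts reducedness.
  have hq0 : ∀ z : ℂ, ‖z‖ ≤ 1 → q'.eval z ≠ 0 := by
    intro a ha h0
    refine hred a h0 ?_
    rcases ha.lt_or_eq with ha | ha
    · ext i j
      have hcl : IsClosed {z : ℂ | ‖(Q' i j).eval z‖ ≤ ‖q'.eval z‖} :=
        isClosed_le (Q' i j).continuous.norm q'.continuous.norm
      have hev : ∀ᶠ z in 𝓝[≠] a, z ∈ {z : ℂ | ‖(Q' i j).eval z‖ ≤ ‖q'.eval z‖} := by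
        have h1 : ∀ᶠ z in 𝓝[≠] a, ‖z‖ < 1 :=
          (continuous_norm.continuousAt.eventually_lt_const ha).filter_mono nhdsWithin_le_nhds
        have h2 : ∀ᶠ z in 𝓝[≠] a, h.eval z ≠ 0 := by
          have : ∀ᶠ z in (cofinite : Filter ℂ), h.eval z ≠ 0 := by
            rw [Filter.eventually_cofinite]
            refine (h.roots.toFinset.finite_toSet).subset fun z hz => ?_
            have hz' : h.eval z = 0 := by simpa using hz
            simp [hh, hz']
          refine this.filter_mono ?_
          rw [Filter.le_cofinite_iff_compl_singleton_mem]
          intro y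
          by_cases hy : y = a
          · subst hy; exact self_mem_nhdsWithin
          · exact mem_nhdsWithin_of_mem_nhds
              (isOpen_compl_singleton.mem_nhds (by simpa using Ne.symm hy))
        filter_upwards [h1, h2] with z hz hz0
        have h3 := hle z hz i j
        simp only [Matrix.smul_apply, smul_eq_mul, eval_mul, norm_mul] at h3
        exact le_of_mul_le_mul_left h3 (norm_pos_iff.2 hz0)
      have := hcl.mem_of_tendsto (f := id) (tendsto_id.mono_left nhdsWithin_le_nhds) hev
      have h4 : ‖(Q' i j).eval a‖ ≤ ‖q'.eval a‖ := this
      rw [h0, norm_zero] at h4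
      simpa using h4
    · have h1 := hQ' a ha
      rw [h0, mul_zero, zero_smul] at h1
      exact Matrix.conjTranspose_mul_self_eq_zero.1 h1
  have hdet' : Q'.det * g = gt * q' ^ Fintype.card m := by
    rw [Matrix.det_smul, mul_pow] at hdet
    refine mul_left_cancel₀ (pow_ne_zero (Fintype.card m) hh) ?_
    linear_combination hdet
  have hne : Q'.det ≠ 0 := by
    intro h0
    rw [h0, zero_mul] at hdet'
    exact mul_ne_zero hgt (pow_ne_zero _ hq') hdet'.symm
  have hcount : discRoots Q'.det ≤ gt.natDegree := by
    have h1 := congrArg discRoots hdet'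
    rw [discRoots_mul hne hg, discRoots_mul hgt (pow_ne_zero _ hq'),
      discRoots_of_ne_zero (f := q' ^ Fintype.card m) fun z hz => by
        rw [eval_pow]; exact pow_ne_zero _ (hq0 z hz.le)] at h1
    have := discRoots_le_natDegree gt
    omega
  obtain ⟨F, hF⟩ := exists_kernel Q' q' hq0 hQ' hne
  refine ⟨_, hcount, h • F, fun w z => ?_⟩
  simp only [evalM_smul, eval_mul, map_mul, Matrix.conjTranspose_smul, Matrix.smul_mul,
    Matrix.mul_smul, smul_smul]
  have h1 := congrArg (fun A => (starRingEnd ℂ (h.eval w) * h.eval z) • A) (hF w z)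
  simp only [smul_sub, smul_smul] at h1
  rw [mul_mul_mul_comm]
  simp only [RCLike.star_def] at h1 ⊢
  rw [mul_comm (h.eval z), h1]
  congr 1
  ring

end Section

/-! ### Coefficient matrices and their Gram matrices -/

/-- The matrix of the `j`-th coefficients. -/
def coefM {R m n : Type*} [Semiring R] (j : ℕ) (Q : Matrix m n R[X]) : Matrix m n R :=
  Q.map fun p => p.coeff j

@[simp] lemma coefM_apply {R m n : Type*} [Semiring R] (k : ℕ) (Q : Matrix m n R[X]) (i : m)
    (j : n) : coefM k Q i j = (Q i j).coeff k := rfl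

lemma coefM_ext {R m n : Type*} [Semiring R] {Q Q' : Matrix m n R[X]}
    (h : ∀ k, coefM k Q = coefM k Q') : Q = Q' := by
  ext i j k
  exact congrFun (congrFun (h k) i) j

lemma coefM_C_mul {R m n k : Type*} [Semiring R] [Fintype n] (j : ℕ) (U : Matrix m n R)
    (Q : Matrix n k R[X]) : coefM j (U.map C * Q) = U * coefM j Q := by
  ext a b
  simp [Matrix.mul_apply, finsetSum_coeff]

lemma coefM_C_smul {R m n : Type*} [Semiring R] (j : ℕ) (c : R)
    (Q : Matrix m n R[X]) : coefM j (C c • Q) = c • coefM j Q := by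
  ext a b
  simp

lemma coefM_fromRows {R m n k : Type*} [Semiring R] (j : ℕ) (A : Matrix m k R[X])
    (B : Matrix n k R[X]) :
    coefM j (Matrix.fromRows A B) = Matrix.fromRows (coefM j A) (coefM j B) := by
  ext (a | a) b <;> rfl

lemma evalM_fromRows {m n k : Type*} (x : ℂ) (A : Matrix m k ℂ[X]) (B : Matrix n k ℂ[X]) :
    evalM x (Matrix.fromRows A B) = Matrix.fromRows (evalM x A) (evalM x B) := by
  ext (a | a) b <;> rfl

lemma fromRows_gram {m n k l : Type*} [Fintype m] [Fintype n] (A : Matrix m k ℂ)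
    (B : Matrix n k ℂ) (A' : Matrix m l ℂ) (B' : Matrix n l ℂ) :
    (Matrix.fromRows A B)ᴴ * Matrix.fromRows A' B' = Aᴴ * A' + Bᴴ * B' := by
  rw [Matrix.conjTranspose_fromRows_eq_fromCols_conjTranspose, Matrix.fromCols_mul_fromRows]

lemma coefM_X_smul_zero {R m n : Type*} [CommSemiring R] (Q : Matrix m n R[X]) :
    coefM 0 ((X : R[X]) • Q) = 0 := by
  ext a b; simp

lemma coefM_X_smul_succ {R m n : Type*} [CommSemiring R] (k : ℕ) (Q : Matrix m n R[X]) :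
    coefM (k + 1) ((X : R[X]) • Q) = coefM k Q := by
  ext a b; simp

lemma coefM_smul_one {R m : Type*} [DecidableEq m] [Semiring R] (k : ℕ) (q : R[X]) :
    coefM k (q • (1 : Matrix m m R[X])) = q.coeff k • (1 : Matrix m m R) := by
  ext a b
  by_cases h : a = b <;> simp [h]

/-- A constant unitary carries `P` to `R`, hence each coefficient of `P` to that of `R`; this
replaces comparing coefficients in `conj w` and `z`. -/
lemma coeff_gram {ρ m : Type*} [Finite m] [Fintype ρ] [DecidableEq ρ] (P R : Matrix ρ m ℂ[X])
    (h : ∀ w z, (evalM w P)ᴴ * evalM z P = (evalM w R)ᴴ * evalM z R) (k j : ℕ) :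
    (coefM k P)ᴴ * coefM j P = (coefM k R)ᴴ * coefM j R := by
  obtain ⟨U, hU, hUP⟩ := exists_unitary_of_gram (fun z => evalM z P) (fun z => evalM z R) h
  have h1 : U.map C * P = R := by
    refine polyMatrix_eq_of_eventually (Eventually.of_forall fun x => ?_)
    rw [evalM_mul, evalM_map_C, hUP]
  have h2 : ∀ j, coefM j R = U * coefM j P := fun j => by rw [← h1, coefM_C_mul]
  rw [h2, h2, Matrix.conjTranspose_mul, Matrix.mul_assoc, ← Matrix.mul_assoc Uᴴ,
    ← Matrix.star_eq_conjTranspose U, Matrix.mem_unitaryGroup_iff'.1 hU, Matrix.one_mul]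

lemma kernel_coeff {m ρ : Type*} [Fintype m] [DecidableEq m] [Fintype ρ] [DecidableEq ρ]
    (Q : Matrix m m ℂ[X]) (q : ℂ[X])
    (F : Matrix ρ m ℂ[X]) (hF : ∀ w z : ℂ,
      (starRingEnd ℂ (q.eval w) * q.eval z) • (1 : Matrix m m ℂ) - (evalM w Q)ᴴ * evalM z Q =
        (1 - z * starRingEnd ℂ w) • ((evalM w F)ᴴ * evalM z F)) (k j : ℕ) :
    (starRingEnd ℂ (q.coeff k) * q.coeff j) • (1 : Matrix m m ℂ) -
      (coefM k Q)ᴴ * coefM j Q = (coefM k F)ᴴ * coefM j F -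
        (coefM k ((X : ℂ[X]) • F))ᴴ * coefM j ((X : ℂ[X]) • F) := by
  have h := coeff_gram (Matrix.fromRows (q • (1 : Matrix m m ℂ[X])) ((X : ℂ[X]) • F))
    (Matrix.fromRows Q F) (fun w z => by
      have h1 := hF w z
      simp only [evalM_fromRows, fromRows_gram, evalM_smul, Matrix.conjTranspose_smul,
        Matrix.smul_mul, Matrix.mul_smul, smul_smul, eval_X]
      rw [evalM_one, evalM_one, Matrix.conjTranspose_one, Matrix.one_mul]
      rw [sub_smul, one_smul, sub_eq_iff_eq_add] at h1
      simp only [RCLike.star_def]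
      rw [mul_comm (q.eval z), h1]
      abel) k j
  simp only [coefM_fromRows, fromRows_gram, coefM_smul_one, Matrix.conjTranspose_smul,
    Matrix.conjTranspose_one, Matrix.smul_mul, Matrix.mul_smul, smul_smul, Matrix.one_mul,
    RCLike.star_def] at h
  rw [sub_eq_sub_iff_add_eq_add, mul_comm, h]
  abel

/-- The Gram matrices of a state sequence, recovered from the differences `M`. -/
def stateGram {A : Type*} [AddCommGroup A] (M : ℕ → ℕ → A) : ℕ → ℕ → A
  | 0, j => M 0 j
  | k + 1, 0 => M (k + 1) 0
  | k + 1, j + 1 => stateGram M k j + M (k + 1) (j + 1)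

/-- `M k j` is the Gram entry at `(k, j)` minus the one at `(k - 1, j - 1)`, so the sum along the
diagonal telescopes. Hence the Gram matrices depend only on `M`, not on the choice of `F`. -/
lemma stateGram_eq {m ρ : Type*} [Fintype ρ] (M : ℕ → ℕ → Matrix m m ℂ) (F : Matrix ρ m ℂ[X])
    (h : ∀ k j, M k j = (coefM k F)ᴴ * coefM j F -
        (coefM k ((X : ℂ[X]) • F))ᴴ * coefM j ((X : ℂ[X]) • F)) (k j : ℕ) :
    stateGram M k j = (coefM k F)ᴴ * coefM j F := by
  induction k generalizing j with
  | zero => rw [stateGram, h, coefM_X_smul_zero]; simp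
  | succ k ih =>
    cases j with
    | zero => rw [stateGram, h, coefM_X_smul_zero]; simp
    | succ j => rw [stateGram, ih, h, coefM_X_smul_succ, coefM_X_smul_succ]; abel

lemma exists_degree_bound {R m n : Type*} [Semiring R] [Fintype m] [Fintype n]
    (F : Matrix m n R[X]) : ∃ d, ∀ k, d ≤ k → coefM k F = 0 := by
  refine ⟨(Finset.univ.sup fun i => Finset.univ.sup fun j => (F i j).natDegree) + 1,
    fun k hk => ?_⟩
  ext i j
  refine coeff_eq_zero_of_natDegree_lt (lt_of_lt_of_le (Nat.lt_succ_of_le ?_) hk)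
  exact (Finset.le_sup (f := fun j => (F i j).natDegree) (Finset.mem_univ j)).trans
    (Finset.le_sup (f := fun i => Finset.univ.sup fun j => (F i j).natDegree)
      (Finset.mem_univ i))

/-- The Gram matrices are constant from `n` on, and vanish far out because `F` is polynomial. -/
lemma coefM_eq_zero_of_stationary {m ρ : Type*} [Fintype ρ] [Fintype m] (F : Matrix ρ m ℂ[X])
    {n : ℕ}
    (h : ∀ k, n ≤ k → (coefM (k + 1) F)ᴴ * coefM (k + 1) F = (coefM k F)ᴴ * coefM k F) {k : ℕ}
    (hk : n ≤ k) : coefM k F = 0 := by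
  have h1 : ∀ i, (coefM (k + i) F)ᴴ * coefM (k + i) F = (coefM k F)ᴴ * coefM k F := by
    intro i
    induction i with
    | zero => rfl
    | succ i ih => rw [← add_assoc, h _ (by omega), ih]
  obtain ⟨d, hd⟩ := exists_degree_bound F
  have h3 : coefM (k + d) F = 0 := hd _ (Nat.le_add_left _ _)
  have h4 := h1 d
  rw [h3, Matrix.mul_zero] at h4
  exact Matrix.conjTranspose_mul_self_eq_zero.1 h4.symm

lemma posSemidef_of_eventually {κ : Type*} [Fintype κ] {T : ℂ → Matrix κ κ ℂ}
    (hc : Continuous T) (h : ∀ᶠ x in circleGen, (T x).PosSemidef) {x : ℂ} (hx : ‖x‖ = 1) :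
    (T x).PosSemidef := by
  refine Matrix.posSemidef_iff_dotProduct_mulVec.2 ⟨?_, fun v => ?_⟩
  · exact eq_of_eventually (f := fun x => (T x)ᴴ) (g := T) hc.matrix_conjTranspose hc
      (h.mono fun y hy => hy.isHermitian) hx
  · exact closed_of_eventually (s := {x | 0 ≤ star v ⬝ᵥ (T x *ᵥ v)})
      (isClosed_le continuous_const
        (continuous_const.dotProduct (hc.matrix_mulVec continuous_const)))
      (h.mono fun y hy => hy.dotProduct_mulVec_nonneg v) hx

end State

/-! ### State polynomials and their intertwiner -/

section Bivariate

/-- The section of a bivariate polynomial at a value of the inner variable. -/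
noncomputable def sec (x : ℂ) : ℂ[X][X] →+* ℂ[X] := mapRingHom (evalRingHom x)

lemma coeff_sec (x : ℂ) (P : ℂ[X][X]) (k : ℕ) : (sec x P).coeff k = (P.coeff k).eval x := by
  simp [sec]

lemma eval_sec (x y : ℂ) (P : ℂ[X][X]) : (sec x P).eval y = P.evalEval x y :=
  map_evalRingHom_eval x y P

lemma natDegree_sec_le (x : ℂ) (P : ℂ[X][X]) : (sec x P).natDegree ≤ P.natDegree :=
  natDegree_map_le

lemma eventually_sec_ne_zero {P : ℂ[X][X]} (hP : P ≠ 0) : ∀ᶠ x in circleGen, sec x P ≠ 0 := by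
  filter_upwards [eventually_eval_ne_zero (leadingCoeff_ne_zero.2 hP)] with x hx h0
  apply hx
  rw [leadingCoeff, ← coeff_sec, h0, coeff_zero]

lemma coefM_map_sec {m n : Type*} (x : ℂ) (Q : Matrix m n ℂ[X][X]) (k : ℕ) :
    coefM k (Q.map (sec x)) = evalM x (coefM k Q) := by
  ext i j
  simp [coeff_sec]

lemma det_map_sec {m : Type*} [Fintype m] [DecidableEq m] (x : ℂ) (Q : Matrix m m ℂ[X][X]) :
    (Q.map (sec x)).det = sec x Q.det := (RingHom.map_det (sec x) Q).symm

/-- The stacked matrix of the inputs and the shifted states. -/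
noncomputable def stateIn {m ρ : Type*} [DecidableEq m] (c : ℂ[X]) (p : ℂ[X][X])
    (E : Matrix ρ m ℂ[X][X]) : Matrix (m ⊕ ρ) m ℂ[X][X] :=
  Matrix.fromRows ((C c * p) • (1 : Matrix m m ℂ[X][X])) ((X : ℂ[X][X]) • E)

/-- The stacked matrix of the outputs and the states. -/
noncomputable def stateOut {m ρ : Type*} (c : ℂ[X]) (Q : Matrix m m ℂ[X][X])
    (E : Matrix ρ m ℂ[X][X]) : Matrix (m ⊕ ρ) m ℂ[X][X] :=
  Matrix.fromRows (C c • Q) E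

variable {m : Type*} [Fintype m] [DecidableEq m]

omit [Fintype m] in
lemma coefM_stateIn {ρ : Type*} (c : ℂ[X]) (p : ℂ[X][X]) (E : Matrix ρ m ℂ[X][X]) (k : ℕ) :
    coefM k (stateIn c p E) = Matrix.fromRows ((c * p.coeff k) • (1 : Matrix m m ℂ[X]))
      (coefM k ((X : ℂ[X][X]) • E)) := by
  rw [stateIn, coefM_fromRows, coefM_smul_one, coeff_C_mul]

omit [DecidableEq m] [Fintype m] in
lemma coefM_stateOut {ρ : Type*} (c : ℂ[X]) (Q : Matrix m m ℂ[X][X]) (E : Matrix ρ m ℂ[X][X])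
    (k : ℕ) : coefM k (stateOut c Q E) = Matrix.fromRows (c • coefM k Q) (coefM k E) := by
  rw [stateOut, coefM_fromRows, coefM_C_smul]

/-- The coefficients of `conj p * p - Qᴴ * Q` in the outer variable. -/
noncomputable def defect (Q : Matrix m m ℂ[X][X]) (p : ℂ[X][X]) (x : ℂ) (k j : ℕ) :
    Matrix m m ℂ :=
  (starRingEnd ℂ ((p.coeff k).eval x) * (p.coeff j).eval x) • (1 : Matrix m m ℂ) -
    (evalM x (coefM k Q))ᴴ * evalM x (coefM j Q)

lemma continuous_defect (Q : Matrix m m ℂ[X][X]) (p : ℂ[X][X]) (k j : ℕ) :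
    Continuous fun x => defect Q p x k j := by
  have h : Continuous fun x => starRingEnd ℂ ((p.coeff k).eval x) * (p.coeff j).eval x :=
    (Complex.continuous_conj.comp (p.coeff k).continuous).mul (p.coeff j).continuous
  exact (h.smul continuous_const).sub
    ((continuous_evalM _).matrix_conjTranspose.matrix_mul (continuous_evalM _))

lemma continuous_stateGram (Q : Matrix m m ℂ[X][X]) (p : ℂ[X][X]) (k j : ℕ) :
    Continuous fun x => stateGram (defect Q p x) k j := by
  induction k generalizing j with
  | zero => exact continuous_defect Q p 0 j
  | succ k ih =>
    cases j with
    | zero => exact continuous_defect Q p (k + 1) 0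
    | succ j => exact (ih j).add (continuous_defect Q p (k + 1) (j + 1))

lemma isTrig_defect (Q : Matrix m m ℂ[X][X]) (p : ℂ[X][X]) (k j : ℕ) (a b : m) :
    IsTrig fun x => defect Q p x k j a b := by
  simp only [defect, Matrix.sub_apply, Matrix.smul_apply, Matrix.mul_apply, smul_eq_mul,
    Matrix.conjTranspose_apply, evalM_apply, RCLike.star_def]
  refine IsTrig.sub (IsTrig.mul (IsTrig.mul (isTrig_conj_poly _) (isTrig_poly _)) ?_)
    (isTrig_sum _ fun i _ => (isTrig_conj_poly _).mul (isTrig_poly _))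
  simpa using isTrig_poly (C ((1 : Matrix m m ℂ) a b))

lemma isTrig_stateGram (Q : Matrix m m ℂ[X][X]) (p : ℂ[X][X]) (k j : ℕ) (a b : m) :
    IsTrig fun x => stateGram (defect Q p x) k j a b := by
  induction k generalizing j with
  | zero => exact isTrig_defect Q p 0 j a b
  | succ k ih =>
    cases j with
    | zero => exact isTrig_defect Q p (k + 1) 0 a b
    | succ j => exact (ih j).add (isTrig_defect Q p (k + 1) (j + 1) a b)

/-- State polynomials for an inner function, with as few rows as the degree of the determinant. -/
theorem exists_state (Q : Matrix m m ℂ[X][X]) (p gt g : ℂ[X][X])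
    (hp0 : ∀ x : ℂ, ‖x‖ < 1 → (p.coeff 0).eval x ≠ 0) (hg : g ≠ 0) (hgt : gt ≠ 0)
    (hdet : Q.det * g = gt * p ^ Fintype.card m)
    (hQ : ∀ x y : ℂ, ‖x‖ = 1 → ‖y‖ = 1 →
      (evalM y (Q.map (sec x)))ᴴ * evalM y (Q.map (sec x)) =
        (starRingEnd ℂ ((sec x p).eval y) * (sec x p).eval y) • (1 : Matrix m m ℂ))
    (hle : ∀ x y : ℂ, ‖x‖ = 1 → ‖y‖ < 1 → ∀ i j,
      ‖(sec x (Q i j)).eval y‖ ≤ ‖(sec x p).eval y‖) :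
    ∃ r ≤ gt.natDegree, ∃ (n : ℕ) (E : Matrix (Fin r) m ℂ[X][X]) (c : ℂ[X]),
      (∀ x : ℂ, ‖x‖ < 1 → c.eval x ≠ 0) ∧
      (∀ k, n < k → coefM k (stateIn c p E) = 0 ∧ coefM k (stateOut c Q E) = 0) ∧
      (∀ᶠ x in circleGen, ∀ k j,
        (evalM x (coefM k (stateIn c p E)))ᴴ * evalM x (coefM j (stateIn c p E)) =
          (evalM x (coefM k (stateOut c Q E)))ᴴ * evalM x (coefM j (stateOut c Q E))) ∧
      ∀ x : ℂ, ‖x‖ < 1 → ∀ v,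
        (∀ k, v ᵥ* evalM x (coefM k (stateIn c p E)) = 0) → v = 0 := by
  have hp : p ≠ 0 := by
    rintro rfl
    exact hp0 0 (by simp) (by simp)
  obtain ⟨n, hn⟩ : ∃ n, ∀ k, n < k → p.coeff k = 0 ∧ coefM k Q = 0 := by
    obtain ⟨d, hd⟩ := exists_degree_bound Q
    exact ⟨p.natDegree + d, fun k hk => ⟨coeff_eq_zero_of_natDegree_lt (by omega),
      hd k (by omega)⟩⟩
  -- No regularity of `F` in `x` is available; only its Gram matrices are used below. Since `F` is
  -- multiplied by the variable in the kernel identity, its degree stays below `n`.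
  have hgen : ∀ᶠ x in circleGen, ∃ s ≤ gt.natDegree, ∃ F : Matrix (Fin s) m ℂ[X],
      (∀ k j, defect Q p x k j = (coefM k F)ᴴ * coefM j F -
        (coefM k ((X : ℂ[X]) • F))ᴴ * coefM j ((X : ℂ[X]) • F)) ∧
      ∀ k, n ≤ k → coefM k F = 0 := by
    filter_upwards [eventually_sec_ne_zero hp, eventually_sec_ne_zero hg,
      eventually_sec_ne_zero hgt, eventually_circle] with x h1 h2 h3 hx
    obtain ⟨s, hs, F, hF⟩ := exists_kernel_of_le (Q.map (sec x)) (sec x p) (sec x gt) (sec x g) h1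
      (fun y hy => hQ x y hx hy) (fun y hy i j => hle x y hx hy i j) h2 h3
      (by rw [det_map_sec, ← map_mul, hdet, map_mul, map_pow])
    have hker := kernel_coeff _ _ _ hF
    simp only [coeff_sec, coefM_map_sec] at hker
    refine ⟨s, hs.trans (natDegree_sec_le x gt), F, hker, fun k hk =>
      coefM_eq_zero_of_stationary F (fun k hk => ?_) hk⟩
    have h4 := hker (k + 1) (k + 1)
    obtain ⟨h5, h6⟩ := hn (k + 1) (by omega)
    rw [h5, h6, coefM_X_smul_succ] at h4
    rw [evalM_zero, eval_zero, mul_zero, zero_smul, Matrix.mul_zero, sub_zero] at h4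
    exact (sub_eq_zero.1 h4.symm)
  let T : ℂ → Matrix (Fin n × m) (Fin n × m) ℂ := fun x =>
    Matrix.of fun a b => stateGram (defect Q p x) a.1 b.1 a.2 b.2
  have hT : ∀ x s (F : Matrix (Fin s) m ℂ[X]),
      (∀ k j, defect Q p x k j = (coefM k F)ᴴ * coefM j F -
        (coefM k ((X : ℂ[X]) • F))ᴴ * coefM j ((X : ℂ[X]) • F)) →
      T x = (Matrix.of fun i (a : Fin n × m) => coefM a.1 F i a.2)ᴴ *
        Matrix.of fun i (a : Fin n × m) => coefM a.1 F i a.2 := by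
    intro x s F hF
    ext a b
    simp only [T, Matrix.of_apply, stateGram_eq _ F hF]
    rfl
  have hTc : Continuous T := continuous_matrix fun a b =>
    (continuous_stateGram Q p a.1 b.1).matrix_elem a.2 b.2
  have hpsd : ∀ᶠ x in circleGen, (T x).PosSemidef := by
    filter_upwards [hgen] with x ⟨s, hs, F, hF, _⟩
    rw [hT x s F hF]
    exact Matrix.posSemidef_conjTranspose_mul_self _
  obtain ⟨r, E₀, c, hc, hE₀, hinj, hrank⟩ := exists_outer_factorization T
    (fun a b => isTrig_stateGram Q p a.1 b.1 a.2 b.2)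
    (fun x hx => posSemidef_of_eventually hTc hpsd hx)
  -- At a generic `x`, `T x` is the Gram matrix of a matrix with `s` rows, so `r ≤ rank (T x) ≤ s`.
  have hr : r ≤ gt.natDegree := by
    obtain ⟨x, hx, s, hs, F, hF, _⟩ := (hrank.and hgen).exists
    refine (hx.trans ?_).trans hs
    rw [hT x s F hF]
    refine (Matrix.rank_mul_le_right _ _).trans ?_
    simpa using Matrix.rank_le_card_height
      (Matrix.of fun i (a : Fin n × m) => coefM a.1 F i a.2)
  let E : Matrix (Fin r) m ℂ[X][X] :=
    Matrix.of fun i b => ∑ k : Fin n, C (E₀ i (k, b)) * X ^ (k : ℕ)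
  have hElt : ∀ (k : Fin n) i b, coefM k E i b = E₀ i (k, b) := by
    intro k i b
    simp only [coefM_apply, E, Matrix.of_apply, finsetSum_coeff, coeff_C_mul, coeff_X_pow]
    rw [Finset.sum_eq_single k]
    · simp
    · intro j _ hj
      rw [if_neg (fun h => hj (Fin.ext h.symm)), mul_zero]
    · simp
  have hEge : ∀ k, n ≤ k → coefM k E = 0 := by
    intro k hk
    ext1 i b
    simp only [coefM_apply, E, Matrix.of_apply, finsetSum_coeff, coeff_C_mul, coeff_X_pow,
      Matrix.zero_apply]
    refine Finset.sum_eq_zero fun j _ => ?_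
    rw [if_neg (by have := j.2; omega), mul_zero]
  refine ⟨r, hr, n, E, c, hc, fun k hk => ?_, ?_, ?_⟩
  · obtain ⟨h5, h6⟩ := hn k hk
    obtain ⟨k, rfl⟩ : ∃ l, k = l + 1 := ⟨k - 1, by omega⟩
    rw [coefM_stateIn, coefM_stateOut, h5, h6, coefM_X_smul_succ, hEge k (by omega),
      hEge (k + 1) (by omega), mul_zero, zero_smul, smul_zero]
    simp
  · filter_upwards [hgen, eventually_circle] with x ⟨s, hs, F, hF, hF0⟩ hx
    have hEF : ∀ k j, (evalM x (coefM k E))ᴴ * evalM x (coefM j E) =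
        (starRingEnd ℂ (c.eval x) * c.eval x) • ((coefM k F)ᴴ * coefM j F) := by
      intro k j
      by_cases hk : n ≤ k
      · rw [hEge k hk, hF0 k hk, evalM_zero]; simp
      by_cases hj : n ≤ j
      · rw [hEge j hj, hF0 j hj, evalM_zero]; simp
      ext a b
      have h1 := congrFun (congrFun (hE₀ x hx) (⟨k, by omega⟩, a)) (⟨j, by omega⟩, b)
      rw [hT x s F hF] at h1
      have h2 : ∀ (k : Fin n) i b, evalM x (coefM k E) i b = evalM x E₀ i (k, b) :=
        fun k i b => by rw [evalM_apply, hElt]; rfl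
      have h3 : ((evalM x (coefM k E))ᴴ * evalM x (coefM j E)) a b =
          ((evalM x E₀)ᴴ * evalM x E₀) (⟨k, by omega⟩, a) (⟨j, by omega⟩, b) := by
        simp only [Matrix.mul_apply, Matrix.conjTranspose_apply, ← h2]
      rw [h3, h1]
      rfl
    have hXEF : ∀ k j, (evalM x (coefM k ((X : ℂ[X][X]) • E)))ᴴ *
        evalM x (coefM j ((X : ℂ[X][X]) • E)) = (starRingEnd ℂ (c.eval x) * c.eval x) •
          ((coefM k ((X : ℂ[X]) • F))ᴴ * coefM j ((X : ℂ[X]) • F)) := by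
      intro k j
      cases k with
      | zero => simp only [coefM_X_smul_zero, evalM_zero]; simp
      | succ k =>
        cases j with
        | zero => simp only [coefM_X_smul_zero, evalM_zero]; simp
        | succ j => simp only [coefM_X_smul_succ, hEF]
    intro k j
    simp only [coefM_stateIn, coefM_stateOut, evalM_fromRows, fromRows_gram, hEF, hXEF,
      evalM_smul, evalM_one]
    have h1 := congrArg (fun A => (starRingEnd ℂ (c.eval x) * c.eval x) • A) (hF k j)
    simp only [defect, smul_sub, smul_smul, sub_eq_sub_iff_add_eq_add] at h1
    simp only [Matrix.conjTranspose_smul, Matrix.smul_mul, Matrix.mul_smul, smul_smul,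
      Matrix.conjTranspose_one, Matrix.one_mul, RCLike.star_def, eval_mul, map_mul]
    rw [add_comm (_ • ((evalM x (coefM k Q))ᴴ * _)), mul_comm (c.eval x) (starRingEnd ℂ _), ← h1]
    congr 2
    ring
  -- Coefficient `0` sees only the invertible block `c p(x, 0)`, which kills the input part of `v`.
  -- Coefficient `k + 1` then sees coefficient `k` of `E`, and outerness kills the rest.
  · intro x hx v hv
    have hv0 : ∀ i, v (Sum.inl i) = 0 := by
      intro i
      have h1 := congrFun (hv 0) i
      rw [coefM_stateIn, coefM_X_smul_zero, evalM_fromRows, evalM_smul, evalM_one, evalM_zero,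
        Matrix.vecMul_fromRows] at h1
      simp only [Matrix.vecMul_zero, add_zero, Matrix.vecMul_smul, Matrix.vecMul_one,
        Pi.smul_apply, Function.comp, smul_eq_mul, Pi.zero_apply, eval_mul] at h1
      exact (mul_eq_zero.1 h1).resolve_left (mul_ne_zero (hc x hx) (hp0 x hx))
    have hvr : (fun i => v (Sum.inr i)) = 0 := by
      refine hinj x hx _ ?_
      funext ⟨k, b⟩
      have h1 := congrFun (hv (k + 1)) b
      rw [coefM_stateIn, coefM_X_smul_succ, evalM_fromRows, Matrix.vecMul_fromRows] at h1
      have h2 : v ∘ Sum.inl = 0 := funext hv0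
      rw [h2, Matrix.zero_vecMul, zero_add] at h1
      refine Eq.trans ?_ h1
      simp only [Matrix.vecMul, dotProduct, evalM_apply, hElt]
      rfl
    funext i
    rcases i with i | i
    · exact hv0 i
    · exact congrFun hvr i

/-- Equal Gram matrices give `(B K)ᴴ B = (A K)ᴴ A = A`. As `B K` is a square isometry it is unitary,
and multiplying by it returns `B`. -/
lemma intertwine_of_gram {ρ κ : Type*} [Fintype ρ] [DecidableEq ρ] [Fintype κ]
    {A B : Matrix ρ κ ℂ} {K : Matrix κ ρ ℂ} (hAK : A * K = 1) (h : Aᴴ * A = Bᴴ * B) :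
    (B * K)ᴴ * (B * K) = 1 ∧ (B * K) * A = B := by
  have h1 : (B * K)ᴴ * (B * K) = 1 := by
    rw [Matrix.conjTranspose_mul, Matrix.mul_assoc, ← Matrix.mul_assoc Bᴴ, ← h, Matrix.mul_assoc Aᴴ,
      hAK, Matrix.mul_one, ← Matrix.conjTranspose_mul, hAK, Matrix.conjTranspose_one]
  refine ⟨h1, ?_⟩
  have h2 : (B * K)ᴴ * B = A := by
    rw [Matrix.conjTranspose_mul, Matrix.mul_assoc, ← h, ← Matrix.mul_assoc,
      ← Matrix.conjTranspose_mul, hAK, Matrix.conjTranspose_one, Matrix.one_mul]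
  rw [← h2, ← Matrix.mul_assoc, mul_eq_one_comm.1 h1, Matrix.one_mul]

omit [DecidableEq m] in
/-- Polynomial matrices with the same Gram matrix on the circle are intertwined by a rational
inner function. -/
theorem exists_intertwiner {ρ : Type*} [Fintype ρ] [DecidableEq ρ] (P R : Matrix ρ m ℂ[X][X])
    (n : ℕ) (hn : ∀ k, n < k → coefM k P = 0 ∧ coefM k R = 0)
    (hgram : ∀ᶠ x in circleGen, ∀ k j,
      (evalM x (coefM k P))ᴴ * evalM x (coefM j P) = (evalM x (coefM k R))ᴴ * evalM x (coefM j R))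
    (hinj : ∀ x : ℂ, ‖x‖ < 1 → ∀ v, (∀ k, v ᵥ* evalM x (coefM k P) = 0) → v = 0) :
    ∃ (V : Matrix ρ ρ ℂ[X]) (q : ℂ[X]), (∀ x : ℂ, ‖x‖ ≤ 1 → q.eval x ≠ 0) ∧
      (∀ x : ℂ, ‖x‖ = 1 → (evalM x V)ᴴ * evalM x V =
        (starRingEnd ℂ (q.eval x) * q.eval x) • (1 : Matrix ρ ρ ℂ)) ∧
      V.map C * P = C q • R := by
  let flat : Matrix ρ m ℂ[X][X] → Matrix ρ (Fin (n + 1) × m) ℂ[X] := fun A =>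
    Matrix.of fun i a => coefM a.1 A i a.2
  have hinj' : ∀ x : ℂ, ‖x‖ < 1 → ∀ v, v ᵥ* evalM x (flat P) = 0 → v = 0 := by
    intro x hx v hv
    refine hinj x hx v fun k => ?_
    by_cases hk : n < k
    · rw [(hn k hk).1]
      rw [evalM_zero, Matrix.vecMul_zero]
    · funext b
      exact congrFun hv (⟨k, by omega⟩, b)
  have hflat : ∀ᶠ x in circleGen,
      (evalM x (flat P))ᴴ * evalM x (flat P) = (evalM x (flat R))ᴴ * evalM x (flat R) := by
    filter_upwards [hgram] with x hx
    ext a b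
    exact congrFun (congrFun (hx a.1 b.1) a.2) b.2
  let K : Matrix (Fin (n + 1) × m) ρ ℂ[X] := (evalM 0 (flat P))ᴴ.map C
  have hdet : (flat P * K).det ≠ 0 := by
    intro h0
    apply det_mul_conjTranspose_ne_zero (hinj' 0 (by simp))
    have := congrArg (eval 0) h0
    rwa [← det_evalM, evalM_mul, evalM_map_C, eval_zero] at this
  -- By Cramer's rule `K adj(P K) / det(P K)` is a right inverse of `flat P`; `V₀` is the
  -- intertwiner cleared of this denominator.
  let V₀ := flat R * (K * (flat P * K).adjugate)
  have hV₀ : ∀ᶠ x in circleGen, (evalM x V₀)ᴴ * evalM x V₀ =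
      (starRingEnd ℂ ((flat P * K).det.eval x) * (flat P * K).det.eval x) • (1 : Matrix ρ ρ ℂ) ∧
      evalM x V₀ * evalM x (flat P) = (flat P * K).det.eval x • evalM x (flat R) := by
    filter_upwards [hflat, eventually_eval_ne_zero hdet] with x hx hx0
    set d := (flat P * K).det.eval x with hd
    have h1 : evalM x (flat P) * (d⁻¹ • evalM x (K * (flat P * K).adjugate)) = 1 := by
      rw [Matrix.mul_smul, ← evalM_mul, ← Matrix.mul_assoc, evalM_mul, ← adjugate_evalM,
        Matrix.mul_adjugate, det_evalM, smul_smul, inv_mul_cancel₀ hx0, one_smul]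
    have h2 : evalM x V₀ = d • (evalM x (flat R) *
        (d⁻¹ • evalM x (K * (flat P * K).adjugate))) := by
      rw [Matrix.mul_smul, smul_smul, mul_inv_cancel₀ hx0, one_smul, ← evalM_mul]
    obtain ⟨h3, h4⟩ := intertwine_of_gram h1 hx
    constructor
    · rw [h2, Matrix.conjTranspose_smul, Matrix.smul_mul, Matrix.mul_smul, smul_smul, h3]
      rfl
    · rw [h2, Matrix.smul_mul, h4]
  obtain ⟨V, q, h, hh, hq, hdq, hV, hred⟩ := exists_reduced V₀ _ hdet
  have hVP : V * flat P = q • flat R := by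
    refine polyMatrix_eq_of_eventually ?_
    filter_upwards [hV₀, eventually_eval_ne_zero hh] with x ⟨_, hx⟩ hx0
    rw [hV, hdq, evalM_smul, eval_mul, Matrix.smul_mul, ← smul_smul] at hx
    rw [evalM_mul, evalM_smul]
    exact smul_right_injective _ hx0 hx
  have hVg : ∀ x : ℂ, ‖x‖ = 1 → (evalM x V)ᴴ * evalM x V =
        (starRingEnd ℂ (q.eval x) * q.eval x) • (1 : Matrix ρ ρ ℂ) := by
    intro x hx
    refine eq_of_eventually (f := fun z => (evalM z V)ᴴ * evalM z V)
      (g := fun z => (starRingEnd ℂ (q.eval z) * q.eval z) • (1 : Matrix ρ ρ ℂ)) ?_ ?_ ?_ hx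
    · exact (continuous_evalM V).matrix_conjTranspose.matrix_mul (continuous_evalM V)
    · exact ((Complex.continuous_conj.comp q.continuous).mul q.continuous).smul continuous_const
    · filter_upwards [hV₀, eventually_eval_ne_zero hh] with x ⟨h1, _⟩ hx0
      rw [hV, hdq, evalM_smul, Matrix.conjTranspose_smul, Matrix.smul_mul, Matrix.mul_smul,
        smul_smul, eval_mul, map_mul, mul_mul_mul_comm, ← smul_smul _ _ (1 : Matrix ρ ρ ℂ)] at h1
      exact smul_right_injective _ (mul_ne_zero ((_root_.map_ne_zero (starRingEnd ℂ)).2 hx0) hx0) h1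
  -- A zero of `q` in the disc would give `V(x) P(x) = 0`, hence `V(x) = 0` since the rows of `P(x)`
  -- are independent. On the circle the Gram identity gives the same contradiction.
  refine ⟨V, q, fun x hx h0 => hred x h0 ?_, hVg, ?_⟩
  · rcases hx.lt_or_eq with hx | hx
    · have h1 := congrArg (evalM x) hVP
      rw [evalM_mul, evalM_smul, h0, zero_smul] at h1
      ext i j
      have h2 := hinj' x hx (evalM x V i) (by
        funext a
        exact congrFun (congrFun h1 i) a)
      exact congrFun h2 j
    · have h1 := hVg x hx
      rw [h0, mul_zero, zero_smul] at h1
      exact Matrix.conjTranspose_mul_self_eq_zero.1 h1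
  · refine coefM_ext fun k => ?_
    rw [coefM_C_mul, coefM_C_smul]
    by_cases hk : n < k
    · rw [(hn k hk).1, (hn k hk).2, Matrix.mul_zero, smul_zero]
    · ext1 i b
      exact congrFun (congrFun hVP i) (⟨k, by omega⟩, b)

end Bivariate

/-! ### Counting the zeros of the intertwiner's determinant -/

section Count

variable {m ρ : Type*} [Fintype m] [DecidableEq m] [Fintype ρ] [DecidableEq ρ]

/-- The determinant of the intertwiner in terms of the determinant of the inner function. -/
theorem det_intertwiner (V : Matrix (m ⊕ ρ) (m ⊕ ρ) ℂ[X]) (q c : ℂ[X]) (Q : Matrix m m ℂ[X][X])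
    (p gt g : ℂ[X][X]) (E : Matrix ρ m ℂ[X][X])
    (hV : V.map C * stateIn c p E = C q • stateOut c Q E)
    (hdet : Q.det * g = gt * p ^ Fintype.card m) (hrel : IsRelPrime gt g)
    (hρ : Fintype.card ρ ≤ gt.natDegree) (hc : c ≠ 0) (hp : p ≠ 0)
    (hVdet : V.det ≠ 0) :
    (-1) ^ Fintype.card ρ * V.det * g.coeff 0 =
      gt.leadingCoeff * q ^ (Fintype.card m + Fintype.card ρ) := by
  obtain ⟨A, B, G, D, rfl⟩ : ∃ A B G D, V = Matrix.fromBlocks A B G D :=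
    ⟨_, _, _, _, (Matrix.fromBlocks_toBlocks V).symm⟩
  have h1 : A.map C * ((C c * p) • (1 : Matrix m m ℂ[X][X])) + B.map C * ((X : ℂ[X][X]) • E) =
        C q • (C c • Q) ∧
      G.map C * ((C c * p) • (1 : Matrix m m ℂ[X][X])) + D.map C * ((X : ℂ[X][X]) • E) =
        C q • E := by
    rw [Matrix.fromBlocks_map, stateIn, stateOut, Matrix.fromBlocks_mul_fromRows] at hV
    constructor
    · ext1 i j
      exact congrFun (congrFun hV (Sum.inl i)) j
    · ext1 i j
      exact congrFun (congrFun hV (Sum.inr i)) j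
  obtain ⟨h1, h2⟩ := h1
  let δ : ℂ[X][X] := (C q • (1 : Matrix ρ ρ ℂ[X][X]) - (X : ℂ[X][X]) • D.map C).det
  -- The system matrix of the realization in the outer variable: `W.det` is, up to powers of `q`,
  -- the numerator of the determinant of the inner function over the denominator `δ`.
  let W : Matrix (m ⊕ ρ) (m ⊕ ρ) ℂ[X][X] := Matrix.fromBlocks (A.map C) ((X : ℂ[X][X]) • B.map C)
    (-(G.map C)) (C q • (1 : Matrix ρ ρ ℂ[X][X]) - (X : ℂ[X][X]) • D.map C)
  have hW1 : W * Matrix.fromBlocks ((C c * p) • (1 : Matrix m m ℂ[X][X])) 0 E 1 =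
      Matrix.fromBlocks ((C q * C c) • Q) ((X : ℂ[X][X]) • B.map C) 0
        (C q • (1 : Matrix ρ ρ ℂ[X][X]) - (X : ℂ[X][X]) • D.map C) := by
    rw [Matrix.fromBlocks_multiply]
    refine Matrix.fromBlocks_inj.2 ⟨?_, ?_, ?_, ?_⟩
    · rw [← smul_smul (C q) (C c) Q, ← h1, Matrix.smul_mul, Matrix.mul_smul _ _ E]
    · simp
    · rw [Matrix.sub_mul, Matrix.smul_mul, Matrix.one_mul, ← h2, Matrix.smul_mul,
        Matrix.mul_smul _ _ E, Matrix.neg_mul]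
      abel
    · simp
  -- After this multiplication the matrix is linear in `X`, so the degree and top coefficient of its
  -- determinant can be read off.
  have hW2 : W * Matrix.fromBlocks ((X : ℂ[X][X]) • (1 : Matrix m m ℂ[X][X])) 0 0 1 =
      (X : ℂ[X][X]) • (Matrix.fromBlocks A B (-G) (-D)).map C +
        (Matrix.fromBlocks 0 0 0 (q • (1 : Matrix ρ ρ ℂ[X]))).map C := by
    rw [Matrix.fromBlocks_multiply, Matrix.fromBlocks_map, Matrix.fromBlocks_map,
      Matrix.fromBlocks_smul, Matrix.fromBlocks_add]
    refine Matrix.fromBlocks_inj.2 ⟨?_, ?_, ?_, ?_⟩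
    · ext1 i j; simp
    · ext1 i j; simp
    · ext1 i j
      simp
      ring
    · ext1 i j
      by_cases h : i = j <;> simp [h] <;> ring
  have hd1 : W.det * (C c * p) ^ Fintype.card m =
      (C q * C c) ^ Fintype.card m * Q.det * δ := by
    have := congrArg Matrix.det hW1
    rw [Matrix.det_mul, Matrix.det_fromBlocks_zero₁₂, Matrix.det_fromBlocks_zero₂₁,
      Matrix.det_smul, Matrix.det_smul, Matrix.det_one, Matrix.det_one, mul_one, mul_one] at this
    exact this
  have hWg : W.det * g = C q ^ Fintype.card m * δ * gt := by
    have hne : (C c * p) ^ Fintype.card m ≠ 0 :=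
      pow_ne_zero _ (mul_ne_zero (C_ne_zero.2 hc) hp)
    refine mul_right_cancel₀ hne ?_
    simp only [mul_pow] at hd1 ⊢
    linear_combination g * hd1 + C q ^ Fintype.card m * C c ^ Fintype.card m * δ * hdet
  have hd2 : W.det * X ^ Fintype.card m =
      ((X : ℂ[X][X]) • (Matrix.fromBlocks A B (-G) (-D)).map C +
        (Matrix.fromBlocks 0 0 0 (q • (1 : Matrix ρ ρ ℂ[X]))).map C).det := by
    rw [← hW2, Matrix.det_mul, Matrix.det_fromBlocks_zero₁₂, Matrix.det_smul, Matrix.det_one,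
      Matrix.det_one, mul_one, mul_one]
  have hA' : (Matrix.fromBlocks A B (-G) (-D)).det = (-1) ^ Fintype.card ρ * (Matrix.fromBlocks A B G D).det := by
    have : Matrix.fromBlocks A B (-G) (-D) =
        Matrix.fromBlocks (1 : Matrix m m ℂ[X]) 0 0 (-1 : Matrix ρ ρ ℂ[X]) *
          Matrix.fromBlocks A B G D := by
      rw [Matrix.fromBlocks_multiply]
      simp
    rw [this, Matrix.det_mul, Matrix.det_fromBlocks_zero₂₁, Matrix.det_one, one_mul,
      Matrix.det_neg, Matrix.det_one, mul_one]
  have hcoeff : W.det.coeff (Fintype.card ρ) = (-1) ^ Fintype.card ρ * (Matrix.fromBlocks A B G D).det := by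
    rw [← hA', ← coeff_det_X_add_C_card _ (Matrix.fromBlocks 0 0 0 (q • (1 : Matrix ρ ρ ℂ[X]))),
      ← hd2, Fintype.card_sum, add_comm, coeff_mul_X_pow]
  have hcne : W.det.coeff (Fintype.card ρ) ≠ 0 := by
    rw [hcoeff]
    exact mul_ne_zero (pow_ne_zero _ (neg_ne_zero.2 one_ne_zero)) hVdet
  have hWne : W.det ≠ 0 := fun h => hcne (by rw [h, coeff_zero])
  have hdeg : W.det.natDegree ≤ Fintype.card ρ := by
    have := natDegree_det_X_add_C_le (Matrix.fromBlocks A B (-G) (-D))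
      (Matrix.fromBlocks 0 0 0 (q • (1 : Matrix ρ ρ ℂ[X])))
    rw [← hd2, natDegree_mul_X_pow _ hWne, Fintype.card_sum] at this
    omega
  obtain ⟨β, hβ⟩ : gt ∣ W.det :=
    hrel.dvd_of_dvd_mul_right (Dvd.intro_left _ hWg.symm)
  have hgtne : gt ≠ 0 := by rintro rfl; rw [zero_mul] at hβ; exact hWne hβ
  have hβne : β ≠ 0 := by rintro rfl; rw [mul_zero] at hβ; exact hWne hβ
  have hdeg2 : W.det.natDegree = gt.natDegree + β.natDegree := by rw [hβ, natDegree_mul hgtne hβne]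
  -- `gt` divides `W.det`, whose degree is exactly `card ρ ≤ deg gt`; so the degrees agree and the
  -- cofactor `β` is constant in the outer variable.
  have hρeq : gt.natDegree = Fintype.card ρ := by omega
  obtain ⟨b, rfl⟩ := natDegree_eq_zero.1 (show β.natDegree = 0 by omega)
  have hb1 : gt.leadingCoeff * b = (-1) ^ Fintype.card ρ * (Matrix.fromBlocks A B G D).det := by
    rw [← hcoeff, hβ, coeff_mul_C, leadingCoeff, hρeq]
  have hgb : g * C b = C q ^ Fintype.card m * δ := by
    refine mul_left_cancel₀ hgtne ?_
    rw [hβ] at hWg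
    linear_combination hWg
  have hδ : δ.coeff 0 = q ^ Fintype.card ρ := by
    rw [coeff_zero_eq_eval_zero]
    have := RingHom.map_det (evalRingHom (0 : ℂ[X]))
      (C q • (1 : Matrix ρ ρ ℂ[X][X]) - (X : ℂ[X][X]) • D.map C)
    rw [coe_evalRingHom] at this
    rw [this]
    have h3 : (evalRingHom (0 : ℂ[X])).mapMatrix
        (C q • (1 : Matrix ρ ρ ℂ[X][X]) - (X : ℂ[X][X]) • D.map C) =
        q • (1 : Matrix ρ ρ ℂ[X]) := by
      ext1 i j
      by_cases h : i = j <;> simp [h]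
    rw [h3, Matrix.det_smul, Matrix.det_one, mul_one]
  have hb2 : g.coeff 0 * b = q ^ (Fintype.card m + Fintype.card ρ) := by
    have := congrArg (fun P : ℂ[X][X] => P.coeff 0) hgb
    simp only [mul_coeff_zero, hδ, ← C_pow, coeff_C_zero] at this
    rw [this, pow_add]
  rw [← hb1, ← hb2]
  ring

end Count

/-! ### The Agler decomposition -/

section Colligation

variable {m : Type*} [Fintype m] [DecidableEq m]

/-- Evaluation of a matrix of bivariate polynomials. -/
noncomputable def evalM₂ {m n : Type*} (x y : ℂ) (Q : Matrix m n ℂ[X][X]) : Matrix m n ℂ :=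
  Q.map (evalEval x y)

lemma evalM₂_eq {m n : Type*} (x y : ℂ) (Q : Matrix m n ℂ[X][X]) :
    evalM₂ x y Q = Q.map (evalEvalRingHom x y) := rfl

/-- The sum of squares decomposition of an inner function on the bidisk. -/
theorem exists_colligation (Q : Matrix m m ℂ[X][X]) (p gt g : ℂ[X][X])
    (hp0 : ∀ x y : ℂ, ‖x‖ < 1 → ‖y‖ < 1 → p.evalEval x y ≠ 0)
    (hg0 : ∀ x y : ℂ, ‖x‖ < 1 → ‖y‖ < 1 → g.evalEval x y ≠ 0) (hgt : gt ≠ 0)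
    (hdet : Q.det * g = gt * p ^ Fintype.card m) (hrel : IsRelPrime gt g)
    (hQ : ∀ x y : ℂ, ‖x‖ = 1 → ‖y‖ = 1 → (evalM₂ x y Q)ᴴ * evalM₂ x y Q =
      (starRingEnd ℂ (p.evalEval x y) * p.evalEval x y) • (1 : Matrix m m ℂ))
    (hle : ∀ x y : ℂ, ‖x‖ = 1 → ‖y‖ < 1 → ∀ i j,
      ‖(Q i j).evalEval x y‖ ≤ ‖p.evalEval x y‖) :
    ∃ r ≤ gt.natDegree, ∃ s ≤ gt.leadingCoeff.natDegree,
      ∃ (G₁ : ℂ → ℂ → Matrix (Fin r) m ℂ) (G₂ : ℂ → ℂ → Matrix (Fin s) m ℂ),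
      ∀ x y x' y' : ℂ, ‖x‖ < 1 → ‖y‖ < 1 → ‖x'‖ < 1 → ‖y'‖ < 1 →
        1 + ((y' • G₁ x' y')ᴴ * (y • G₁ x y) + (x' • G₂ x' y')ᴴ * (x • G₂ x y)) =
        ((p.evalEval x' y')⁻¹ • evalM₂ x' y' Q)ᴴ * ((p.evalEval x y)⁻¹ • evalM₂ x y Q) +
          ((G₁ x' y')ᴴ * G₁ x y + (G₂ x' y')ᴴ * G₂ x y) := by
  have hcoeff0 : ∀ (P : ℂ[X][X]) x, (P.coeff 0).eval x = P.evalEval x 0 := by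
    intro P x
    rw [evalEval, C_0, coeff_zero_eq_eval_zero]
  have hg : g ≠ 0 := by
    rintro rfl
    exact hg0 0 0 (by simp) (by simp) (by simp)
  have hp : p ≠ 0 := by
    rintro rfl
    exact hp0 0 0 (by simp) (by simp) (by simp)
  have hsecM : ∀ x y, evalM y (Q.map (sec x)) = evalM₂ x y Q := by
    intro x y
    ext1 i j
    exact eval_sec x y _
  obtain ⟨r, hr, n, E, c, hc, hn, hgram, hinj⟩ := exists_state Q p gt g
    (fun x hx => by rw [hcoeff0]; exact hp0 x 0 hx (by simp)) hg hgt hdet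
    (fun x y hx hy => by rw [hsecM, eval_sec]; exact hQ x y hx hy)
    (fun x y hx hy i j => by rw [eval_sec, eval_sec]; exact hle x y hx hy i j)
  obtain ⟨V, q, hq, hV, hVE⟩ := exists_intertwiner (stateIn c p E) (stateOut c Q E) n hn hgram hinj
  have hc0 : c ≠ 0 := by
    rintro rfl
    exact hc 0 (by simp) (by simp)
  have hVdet : V.det ≠ 0 := by
    intro h0
    have h1 := congrArg Matrix.det (hV 1 (by simp))
    rw [Matrix.det_mul, det_evalM, h0, eval_zero, mul_zero, Matrix.det_smul, Matrix.det_one,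
      mul_one] at h1
    have h2 := hq 1 (by simp)
    exact pow_ne_zero _ (mul_ne_zero ((_root_.map_ne_zero _).2 h2) h2) h1.symm
  have hs : discRoots V.det ≤ gt.leadingCoeff.natDegree := by
    have h1 := det_intertwiner V q c Q p gt g E hVE hdet hrel (by simpa using hr) hc0 hp hVdet
    have h2 : V.det * g.coeff 0 = (C ((-1) ^ Fintype.card (Fin r)) * gt.leadingCoeff) *
        q ^ (Fintype.card m + Fintype.card (Fin r)) := by
      rw [mul_assoc, ← h1, ← mul_assoc, ← mul_assoc, C_pow, C_neg, C_1, ← mul_pow]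
      simp
    have hq0 : q ≠ 0 := by
      rintro rfl
      exact hq 0 (by simp) (by simp)
    have hg00 : ∀ x : ℂ, ‖x‖ < 1 → (g.coeff 0).eval x ≠ 0 := fun x hx => by
      rw [hcoeff0]; exact hg0 x 0 hx (by simp)
    have hgc : g.coeff 0 ≠ 0 := by
      intro h
      exact hg00 0 (by simp) (by rw [h, eval_zero])
    have hsgn : C ((-1 : ℂ) ^ Fintype.card (Fin r)) ≠ 0 :=
      C_ne_zero.2 (pow_ne_zero _ (neg_ne_zero.2 one_ne_zero))
    have h3 := congrArg discRoots h2
    rw [discRoots_mul hVdet hgc, discRoots_mul (mul_ne_zero hsgn (leadingCoeff_ne_zero.2 hgt))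
      (pow_ne_zero _ hq0), discRoots_of_ne_zero hg00,
      discRoots_of_ne_zero (f := q ^ (Fintype.card m + Fintype.card (Fin r))) fun z hz => by
        rw [eval_pow]; exact pow_ne_zero _ (hq z hz.le)] at h3
    have h4 := discRoots_le_natDegree (C ((-1 : ℂ) ^ Fintype.card (Fin r)) * gt.leadingCoeff)
    have h5 := natDegree_C_mul_le ((-1 : ℂ) ^ Fintype.card (Fin r)) gt.leadingCoeff
    omega
  obtain ⟨F, hF⟩ := exists_kernel V q hq hV hVdet
  let G₁ : ℂ → ℂ → Matrix (Fin r) m ℂ := fun x y => (c.eval x * p.evalEval x y)⁻¹ • evalM₂ x y E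
  let S : ℂ → ℂ → Matrix (m ⊕ Fin r) m ℂ := fun x y => Matrix.fromRows 1 (y • G₁ x y)
  let O : ℂ → ℂ → Matrix (m ⊕ Fin r) m ℂ := fun x y =>
    Matrix.fromRows ((p.evalEval x y)⁻¹ • evalM₂ x y Q) (G₁ x y)
  have hVSO : ∀ x y : ℂ, ‖x‖ < 1 → ‖y‖ < 1 → evalM x V * S x y = q.eval x • O x y := by
    intro x y hx hy
    have hcx := hc x hx
    have hpx := hp0 x y hx hy
    have h1 := congrArg (fun A => (c.eval x * p.evalEval x y)⁻¹ • evalM₂ x y A) hVE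
    have h2 : evalM₂ x y (V.map C * stateIn c p E) = evalM x V * evalM₂ x y (stateIn c p E) := by
      rw [evalM₂_eq, evalM₂_eq, Matrix.map_mul]
      congr 1
      ext1 i j
      simp
    have h3 : evalM₂ x y (C q • stateOut c Q E) = q.eval x • evalM₂ x y (stateOut c Q E) := by
      ext1 i j
      simp [evalM₂, evalEval_C]
    have h4 : (c.eval x * p.evalEval x y)⁻¹ • evalM₂ x y (stateIn c p E) = S x y := by
      ext1 (i | i) j
      · by_cases h : i = j
        · simp only [evalM₂, stateIn, S, h, Matrix.smul_apply, Matrix.map_apply,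
            Matrix.fromRows_apply_inl, Matrix.one_apply_eq, smul_eq_mul, mul_one, evalEval_mul,
            evalEval_C]
          exact inv_mul_cancel₀ (mul_ne_zero hcx hpx)
        · simp [evalM₂, stateIn, S, h]
      · simp [evalM₂, stateIn, S, G₁]
        ring
    have h5 : (c.eval x * p.evalEval x y)⁻¹ • evalM₂ x y (stateOut c Q E) = O x y := by
      ext1 (i | i) j
      · simp [evalM₂, stateOut, O, evalEval_C]
        field_simp
      · simp [evalM₂, stateOut, O, G₁]
    simp only [h2, h3] at h1
    rw [← Matrix.mul_smul, h4, smul_comm, h5] at h1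
    exact h1
  -- Sandwiching the kernel identity of `V` between `S` and dividing by the `q` factors gives `S* S
  -- - O* O = (1 - x conj x') G₂* G₂`.
  let G₂ : ℂ → ℂ → Matrix (Fin (discRoots V.det)) m ℂ := fun x y =>
    (q.eval x)⁻¹ • (evalM x F * S x y)
  refine ⟨r, hr, _, hs, G₁, G₂, fun x y x' y' hx hy hx' hy' => ?_⟩
  have hqx := hq x hx.le
  have hqx' : starRingEnd ℂ (q.eval x') ≠ 0 := (_root_.map_ne_zero _).2 (hq x' hx'.le)
  have h1 := congrArg (fun A => (S x' y')ᴴ * A * S x y) (hF x' x)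
  have h2 : (S x' y')ᴴ * ((evalM x' V)ᴴ * evalM x V) * S x y =
      (starRingEnd ℂ (q.eval x') * q.eval x) • ((O x' y')ᴴ * O x y) := by
    rw [Matrix.mul_assoc, Matrix.mul_assoc, hVSO x y hx hy, ← Matrix.mul_assoc,
      ← Matrix.conjTranspose_mul, hVSO x' y' hx' hy', Matrix.conjTranspose_smul, Matrix.smul_mul,
      Matrix.mul_smul, smul_smul]
    rfl
  have h3 : (S x' y')ᴴ * ((evalM x' F)ᴴ * evalM x F) * S x y =
      (starRingEnd ℂ (q.eval x') * q.eval x) • ((G₂ x' y')ᴴ * G₂ x y) := by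
    simp only [G₂, Matrix.conjTranspose_smul, Matrix.smul_mul, Matrix.mul_smul, smul_smul,
      Matrix.conjTranspose_mul, RCLike.star_def, map_inv₀]
    rw [show starRingEnd ℂ (q.eval x') * q.eval x *
      ((q.eval x)⁻¹ * (starRingEnd ℂ (q.eval x'))⁻¹) = 1 by field_simp, one_smul]
    simp only [Matrix.mul_assoc]
  simp only [Matrix.mul_sub, Matrix.sub_mul, h2, Matrix.mul_smul, Matrix.smul_mul, h3,
    Matrix.mul_one] at h1
  rw [smul_comm (1 - x * starRingEnd ℂ x'), ← smul_sub] at h1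
  have h4 := smul_right_injective _ (mul_ne_zero hqx' hqx) h1
  rw [sub_smul, one_smul] at h4
  simp only [S, O, fromRows_gram, Matrix.conjTranspose_one, Matrix.one_mul] at h4
  have h5 : (x' • G₂ x' y')ᴴ * (x • G₂ x y) =
      (x * starRingEnd ℂ x') • ((G₂ x' y')ᴴ * G₂ x y) := by
    rw [Matrix.conjTranspose_smul, Matrix.smul_mul, Matrix.mul_smul, smul_smul, mul_comm]
    rfl
  rw [sub_eq_sub_iff_add_eq_add] at h4
  rw [h5, ← add_assoc, h4]
  abel

end Colligation

/-! ### Two models of polynomials in two variables -/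

section Translation

/-- Polynomials in two variables as polynomials in `z 0` whose coefficients are polynomials
in `z 1`. -/
noncomputable def toBi : MvPolynomial (Fin 2) ℂ ≃ₐ[ℂ] ℂ[X][X] :=
  (MvPolynomial.finSuccEquiv ℂ 1).trans
    (Polynomial.mapAlgEquiv (MvPolynomial.uniqueAlgEquiv ℂ (Fin 1)))

lemma evalEval_toBi (z : Fin 2 → ℂ) (f : MvPolynomial (Fin 2) ℂ) :
    (toBi f).evalEval (z 1) (z 0) = MvPolynomial.eval z f := by
  have h : (evalEvalRingHom (z 1) (z 0)).comp (toBi : MvPolynomial (Fin 2) ℂ →+* ℂ[X][X]) =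
      MvPolynomial.eval z := by
    refine MvPolynomial.ringHom_ext (fun a => ?_) fun i => ?_
    · simp [toBi, MvPolynomial.finSuccEquiv_apply, MvPolynomial.uniqueAlgEquiv]
    · have h1 : MvPolynomial.finSuccEquiv ℂ 1 (MvPolynomial.X 1) =
          Polynomial.C (MvPolynomial.X 0) := MvPolynomial.finSuccEquiv_X_succ (j := (0 : Fin 1))
      fin_cases i
      · simp [toBi, MvPolynomial.finSuccEquiv_apply]
      · simp [toBi, h1, MvPolynomial.uniqueAlgEquiv]
  exact congrArg (fun F : MvPolynomial (Fin 2) ℂ →+* ℂ => F f) h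

lemma toBi_apply (f : MvPolynomial (Fin 2) ℂ) :
    toBi f = (MvPolynomial.finSuccEquiv ℂ 1 f).map
      (MvPolynomial.uniqueAlgEquiv ℂ (Fin 1) : MvPolynomial (Fin 1) ℂ →+* ℂ[X]) := rfl

lemma natDegree_toBi (f : MvPolynomial (Fin 2) ℂ) : (toBi f).natDegree = f.degreeOf 0 := by
  rw [toBi_apply, natDegree_map_eq_of_injective, MvPolynomial.natDegree_finSuccEquiv]
  exact (MvPolynomial.uniqueAlgEquiv ℂ (Fin 1)).injective

lemma natDegree_coeff_toBi_le (f : MvPolynomial (Fin 2) ℂ) (k : ℕ) :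
    ((toBi f).coeff k).natDegree ≤ f.degreeOf 1 := by
  refine le_trans ?_ (MvPolynomial.degreeOf_coeff_finSuccEquiv f 0 k)
  rw [toBi_apply, coeff_map, natDegree_le_iff_coeff_eq_zero]
  intro n hn
  by_contra hne
  have h := MvPolynomial.coeff_uniqueAlgEquiv ℂ ((MvPolynomial.finSuccEquiv ℂ 1 f).coeff k) n
  have h2 := MvPolynomial.degreeOf_le_iff.1 (le_refl (MvPolynomial.degreeOf 0
    ((MvPolynomial.finSuccEquiv ℂ 1 f).coeff k))) (Finsupp.single default n)
    (MvPolynomial.mem_support_iff.2 (h ▸ hne))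
  have h3 : (Finsupp.single (default : Fin 1) n) 0 = n := by
    rw [Subsingleton.elim (0 : Fin 1) default, Finsupp.single_eq_same]
  omega

lemma isRelPrime_toBi {f g : MvPolynomial (Fin 2) ℂ} (h : IsRelPrime f g) :
    IsRelPrime (toBi f) (toBi g) := by
  intro d hf hg
  have h1 := h (d := toBi.symm d) (by simpa using map_dvd toBi.symm hf)
    (by simpa using map_dvd toBi.symm hg)
  simpa using h1.map toBi

/-- Evaluation of a matrix of polynomials in two variables. -/
noncomputable def evalMv {m n : Type*} (z : Fin 2 → ℂ) (Q : Matrix m n (MvPolynomial (Fin 2) ℂ)) :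
    Matrix m n ℂ := Q.map (MvPolynomial.eval z)

lemma evalM₂_toBi {m n : Type*} (x y : ℂ) (Q : Matrix m n (MvPolynomial (Fin 2) ℂ)) :
    evalM₂ x y (Q.map toBi) = evalMv ![y, x] Q := by
  ext1 i j
  exact evalEval_toBi ![y, x] (Q i j)

lemma det_evalMv {m : Type*} [Fintype m] [DecidableEq m] (z : Fin 2 → ℂ)
    (Q : Matrix m m (MvPolynomial (Fin 2) ℂ)) :
    (evalMv z Q).det = MvPolynomial.eval z Q.det :=
  (RingHom.map_det (MvPolynomial.eval z) Q).symm

lemma continuous_evalMv {m n : Type*} (Q : Matrix m n (MvPolynomial (Fin 2) ℂ)) :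
    Continuous fun z => evalMv z Q :=
  continuous_matrix fun i j => MvPolynomial.continuous_eval (Q i j)

lemma eq_of_eval_bidisk {f g : MvPolynomial (Fin 2) ℂ}
    (h : ∀ z ∈ bidisk, MvPolynomial.eval z f = MvPolynomial.eval z g) : f = g := by
  refine MvPolynomial.funext_set (fun _ => Metric.ball (0 : ℂ) 1)
    (fun _ => infinite_of_mem_nhds 0 (Metric.ball_mem_nhds _ one_pos)) fun z hz => h z fun j => ?_
  simpa using hz j (Set.mem_univ j)

/-- Choose a generic `z 1` on the circle, so that the section stays nonzero, and then a generic `z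
0`. -/
lemma exists_torus_eval_ne_zero {f : MvPolynomial (Fin 2) ℂ} (hf : f ≠ 0) :
    ∃ z : Fin 2 → ℂ, (∀ j, ‖z j‖ = 1) ∧ MvPolynomial.eval z f ≠ 0 := by
  have hne : toBi f ≠ 0 := (map_ne_zero_iff toBi toBi.injective).2 hf
  obtain ⟨x, hx, hx1⟩ := ((eventually_sec_ne_zero hne).and eventually_circle).exists
  obtain ⟨y, hy, hy1⟩ := ((eventually_eval_ne_zero hx).and eventually_circle).exists
  refine ⟨![y, x], fun j => by fin_cases j <;> simpa, ?_⟩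
  rw [← evalEval_toBi]
  rwa [eval_sec] at hy

end Translation

/-! ### Boundary values on the torus -/

section Boundary

variable {N : ℕ} {φ : (Fin 2 → ℂ) → Matrix (Fin N) (Fin N) ℂ}
  {Q : Matrix (Fin N) (Fin N) (MvPolynomial (Fin 2) ℂ)} {p : MvPolynomial (Fin 2) ℂ}

lemma eval_smul_eq (hp : ∀ z ∈ bidisk, MvPolynomial.eval z p ≠ 0)
    (hQ : ∀ z ∈ bidisk, ∀ i j, φ z i j = MvPolynomial.eval z (Q i j) / MvPolynomial.eval z p)
    {z : Fin 2 → ℂ} (hz : z ∈ bidisk) : MvPolynomial.eval z p • φ z = evalMv z Q := by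
  ext1 i j
  rw [Matrix.smul_apply, hQ z hz, smul_eq_mul, mul_div_cancel₀ _ (hp z hz)]
  rfl

lemma radialPoint_mem {r : ℝ} (hr : 0 < r) (hr1 : r < 1) (θ : Fin 2 → ℝ) :
    radialPoint r θ ∈ bidisk := fun j => by
  rw [radialPoint, norm_mul, Complex.norm_exp_ofReal_mul_I, mul_one, Complex.norm_real,
    Real.norm_of_nonneg hr.le]
  exact hr1

lemma continuous_radialPoint (θ : Fin 2 → ℝ) : Continuous fun r => radialPoint r θ :=
  continuous_pi fun j => by unfold radialPoint; fun_prop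

lemma exists_angle {x : ℂ} (hx : ‖x‖ = 1) :
    ∃ t ∈ Set.Icc (0 : ℝ) (2 * Real.pi), Complex.exp ((t : ℂ) * Complex.I) = x := by
  have h := Complex.norm_mul_exp_arg_mul_I x
  rw [hx, Complex.ofReal_one, one_mul] at h
  have h1 := Complex.neg_pi_lt_arg x
  have h2 := Complex.arg_le_pi x
  rcases le_total 0 x.arg with h0 | h0
  · exact ⟨x.arg, ⟨h0, by linarith [Real.pi_pos]⟩, h⟩
  · refine ⟨x.arg + 2 * Real.pi, ⟨by linarith, by linarith⟩, ?_⟩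
    push_cast
    rw [add_mul, Complex.exp_add, Complex.exp_two_pi_mul_I, mul_one, h]

/-- The numerator of a rational inner function is a multiple of a unitary matrix at every point of
the torus. -/
theorem torus_gram (hφ : IsInner φ) (hp : ∀ z ∈ bidisk, MvPolynomial.eval z p ≠ 0)
    (hQ : ∀ z ∈ bidisk, ∀ i j, φ z i j = MvPolynomial.eval z (Q i j) / MvPolynomial.eval z p)
    {z : Fin 2 → ℂ} (hz : ∀ j, ‖z j‖ = 1) :
    (evalMv z Q)ᴴ * evalMv z Q =
      (starRingEnd ℂ (MvPolynomial.eval z p) * MvPolynomial.eval z p) • 1 := by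
  have hae : (fun θ : Fin 2 → ℝ => (evalMv (radialPoint 1 θ) Q)ᴴ * evalMv (radialPoint 1 θ) Q)
      =ᵐ[volume.restrict (Set.Icc (0 : Fin 2 → ℝ) (fun _ => 2 * Real.pi))]
      fun θ => (starRingEnd ℂ (MvPolynomial.eval (radialPoint 1 θ) p) *
        MvPolynomial.eval (radialPoint 1 θ) p) • (1 : Matrix (Fin N) (Fin N) ℂ) := by
    filter_upwards [hφ.unitary_boundary] with θ ⟨V, hV, hlim⟩
    have hr : Tendsto (fun r : ℝ => radialPoint r θ) (𝓝[<] 1) (𝓝 (radialPoint 1 θ)) :=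
      ((continuous_radialPoint θ).tendsto 1).mono_left nhdsWithin_le_nhds
    have h1 : Tendsto (fun r : ℝ => MvPolynomial.eval (radialPoint r θ) p • φ (radialPoint r θ))
        (𝓝[<] 1) (𝓝 (MvPolynomial.eval (radialPoint 1 θ) p • V)) :=
      (((MvPolynomial.continuous_eval p).tendsto _).comp hr).smul hlim
    have h2 : Tendsto (fun r : ℝ => MvPolynomial.eval (radialPoint r θ) p • φ (radialPoint r θ))
        (𝓝[<] 1) (𝓝 (evalMv (radialPoint 1 θ) Q)) := by
      refine (((continuous_evalMv Q).tendsto _).comp hr).congr' ?_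
      filter_upwards [Ioo_mem_nhdsLT (zero_lt_one' ℝ)] with r hr
      exact (eval_smul_eq hp hQ (radialPoint_mem hr.1 hr.2 θ)).symm
    have hVV : Vᴴ * V = 1 := Matrix.mem_unitaryGroup_iff'.1 hV
    rw [tendsto_nhds_unique h2 h1, Matrix.conjTranspose_smul, Matrix.smul_mul, Matrix.mul_smul,
      hVV, smul_smul]
    rfl
  have hc : Continuous fun θ : Fin 2 → ℝ => radialPoint 1 θ :=
    continuous_pi fun j => by unfold radialPoint; fun_prop
  have hcQ := (continuous_evalMv Q).comp hc
  have hcp := (MvPolynomial.continuous_eval p).comp hc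
  -- Both sides are continuous in the angles and the closed square is the closure of its interior,
  -- so almost everywhere improves to everywhere.
  have heq := Measure.eqOn_of_ae_eq hae
    (hcQ.matrix_conjTranspose.matrix_mul hcQ).continuousOn
    (((Complex.continuous_conj.comp hcp).mul hcp).smul continuous_const).continuousOn (by
      have : Set.Icc (0 : Fin 2 → ℝ) (fun _ => 2 * Real.pi) =
          Set.univ.pi fun _ => Set.Icc 0 (2 * Real.pi) := (Set.pi_univ_Icc _ _).symm
      rw [this, interior_pi_set Set.finite_univ, closure_pi_set]
      simp only [interior_Icc]
      rw [closure_Ioo (by positivity)])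
  choose θ hθ hθz using fun j => exists_angle (hz j)
  have hr : radialPoint 1 θ = z := funext fun j => by simp [radialPoint, hθz]
  have := heq (show θ ∈ Set.Icc _ _ from ⟨fun j => (hθ j).1, fun j => (hθ j).2⟩)
  simpa only [hr] using this

lemma norm_entry_le {M : Matrix (Fin N) (Fin N) ℂ}
    (h : ‖Matrix.toEuclideanCLM (n := Fin N) (𝕜 := ℂ) M‖ ≤ 1) (i j : Fin N) : ‖M i j‖ ≤ 1 := by
  have h1 := (Matrix.toEuclideanCLM (n := Fin N) (𝕜 := ℂ) M).le_of_opNorm_le h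
    (EuclideanSpace.single j 1)
  have h2 := PiLp.norm_apply_le
    (Matrix.toEuclideanCLM (n := Fin N) (𝕜 := ℂ) M (EuclideanSpace.single j 1)) i
  rw [PiLp.norm_single, norm_one, mul_one] at h1
  refine le_trans (le_of_eq ?_) (h2.trans h1)
  simp [Matrix.ofLp_toEuclideanCLM]

/-- Entries of a contraction have modulus at most one; shrinking `z` radially extends the bound to
the closed bidisk. -/
lemma norm_eval_le (hφ : IsInner φ) (hp : ∀ z ∈ bidisk, MvPolynomial.eval z p ≠ 0)
    (hQ : ∀ z ∈ bidisk, ∀ i j, φ z i j = MvPolynomial.eval z (Q i j) / MvPolynomial.eval z p)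
    {z : Fin 2 → ℂ} (hz : ∀ j, ‖z j‖ ≤ 1) (i j : Fin N) :
    ‖MvPolynomial.eval z (Q i j)‖ ≤ ‖MvPolynomial.eval z p‖ := by
  have hc : Tendsto (fun r : ℝ => (r : ℂ) • z) (𝓝[<] 1) (𝓝 z) := by
    have : Continuous fun r : ℝ => (r : ℂ) • z := by fun_prop
    simpa using (this.tendsto 1).mono_left nhdsWithin_le_nhds
  refine le_of_tendsto_of_tendsto (((MvPolynomial.continuous_eval (Q i j)).norm.tendsto z).comp hc)
    (((MvPolynomial.continuous_eval p).norm.tendsto z).comp hc) ?_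
  filter_upwards [Ioo_mem_nhdsLT (zero_lt_one' ℝ)] with r hr
  have hmem : (r : ℂ) • z ∈ bidisk := fun k => by
    rw [Pi.smul_apply, norm_smul, Complex.norm_real, Real.norm_of_nonneg hr.1.le]
    exact (mul_le_of_le_one_right hr.1.le (hz k)).trans_lt hr.2
  have h1 := norm_entry_le (hφ.contractive _ hmem) i j
  rw [hQ _ hmem, norm_div, div_le_one (norm_pos_iff.2 (hp _ hmem))] at h1
  exact h1

end Boundary

/-! ### Realizations and the degree bound -/

section Realization

lemma blockDiag_eq (k₁ k₂ : ℕ) (z : Fin 2 → ℂ) :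
    blockDiag k₁ k₂ z = Matrix.diagonal fun j => z (Sum.elim (fun _ => 0) (fun _ => 1) j) := by
  ext i j
  rcases i with i | i <;> rcases j with j | j <;>
    simp [blockDiag, Matrix.diagonal_apply, Matrix.one_apply]

variable {N k₁ k₂ : ℕ}

/-- The matrix inverted in the transfer function is invertible on the bidisk. -/
lemma det_one_sub_ne_zero {U : Matrix (Fin N ⊕ (Fin k₁ ⊕ Fin k₂)) (Fin N ⊕ (Fin k₁ ⊕ Fin k₂)) ℂ}
    (hU : U ∈ Matrix.unitaryGroup (Fin N ⊕ (Fin k₁ ⊕ Fin k₂)) ℂ) {z : Fin 2 → ℂ}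
    (hz : z ∈ bidisk) : (1 - U.toBlocks₂₂ * blockDiag k₁ k₂ z).det ≠ 0 := by
  intro h0
  obtain ⟨v, hv, hv0⟩ := Matrix.exists_mulVec_eq_zero_iff.2 h0
  set w := blockDiag k₁ k₂ z *ᵥ v with hw
  have hvw : v = U.toBlocks₂₂ *ᵥ w := by
    rw [Matrix.sub_mulVec, Matrix.one_mulVec, sub_eq_zero, ← Matrix.mulVec_mulVec] at hv0
    exact hv0
  have hwj : ∀ j, w j = z (Sum.elim (fun _ => 0) (fun _ => 1) j) * v j := fun j => by
    rw [hw, blockDiag_eq, Matrix.mulVec_diagonal]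
  -- `U` sends `(0, w)` to `(B w, v)`, so `‖v‖ ≤ ‖w‖`, while `w = d(z) v` is strictly shorter than
  -- the nonzero `v`.
  have hn := norm_toLp_mulVec_of_gram (M := U) (c := 1)
    (by simpa [Matrix.star_eq_conjTranspose] using Matrix.mem_unitaryGroup_iff'.1 hU) (Sum.elim 0 w)
  have hsq := congrArg (· ^ 2) hn
  have hUw : U *ᵥ Sum.elim 0 w = Sum.elim (U.toBlocks₁₂ *ᵥ w) v := by
    conv_lhs => rw [← Matrix.fromBlocks_toBlocks U, Matrix.fromBlocks_mulVec]
    simp [← hvw]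
  rw [hUw, norm_one, one_mul] at hsq
  simp only [EuclideanSpace.norm_sq_eq, Fintype.sum_sum_type (α₁ := Fin N), Sum.elim_inl,
    Sum.elim_inr, Pi.zero_apply, norm_zero] at hsq
  have hpos : 0 ≤ ∑ i, ‖(U.toBlocks₁₂ *ᵥ w) i‖ ^ 2 := Finset.sum_nonneg fun _ _ => by positivity
  have hlt : ∑ j, ‖w j‖ ^ 2 < ∑ j, ‖v j‖ ^ 2 := by
    obtain ⟨j, hj⟩ := Function.ne_iff.1 hv
    refine Finset.sum_lt_sum (fun j _ => ?_) ⟨j, Finset.mem_univ _, ?_⟩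
    · rw [hwj, norm_mul, mul_pow]
      exact mul_le_of_le_one_left (by positivity) (pow_le_one₀ (norm_nonneg _) (hz _).le)
    · rw [hwj, norm_mul, mul_pow]
      have : 0 < ‖v j‖ ^ 2 := by
        have := norm_pos_iff.2 hj
        positivity
      exact mul_lt_of_lt_one_left this (pow_lt_one₀ (norm_nonneg _) (hz _) two_ne_zero)
  rw [zero_pow two_ne_zero, Finset.sum_const_zero, zero_add] at hsq
  linarith

/-- A colligation identity yields a unitary transfer function realization. -/
theorem hasRealization_of_colligation {φ : (Fin 2 → ℂ) → Matrix (Fin N) (Fin N) ℂ}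
    (G₁ : (Fin 2 → ℂ) → Matrix (Fin k₁) (Fin N) ℂ) (G₂ : (Fin 2 → ℂ) → Matrix (Fin k₂) (Fin N) ℂ)
    (h : ∀ w ∈ bidisk, ∀ z ∈ bidisk,
      1 + ((w 0 • G₁ w)ᴴ * (z 0 • G₁ z) + (w 1 • G₂ w)ᴴ * (z 1 • G₂ z)) =
        (φ w)ᴴ * φ z + ((G₁ w)ᴴ * G₁ z + (G₂ w)ᴴ * G₂ z)) :
    HasRealization φ k₁ k₂ := by
  -- The lurking isometry: a single `U` sends `(1, d(z) G)` to `(φ, G)` for every `z`. Its second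
  -- row is solved for `G` and substituted into the first.
  obtain ⟨U, hU, hUX⟩ := exists_unitary_of_gram (ι := bidisk)
    (fun z => Matrix.fromRows (1 : Matrix (Fin N) (Fin N) ℂ)
      (Matrix.fromRows (z.1 0 • G₁ z.1) (z.1 1 • G₂ z.1)))
    (fun z => Matrix.fromRows (φ z.1) (Matrix.fromRows (G₁ z.1) (G₂ z.1)))
    (fun w z => by
      simp only [fromRows_gram, Matrix.conjTranspose_one, Matrix.one_mul]
      exact h w.1 w.2 z.1 z.2)
  refine ⟨U, hU, fun z hz => ?_⟩
  have hd : Matrix.fromRows (z 0 • G₁ z) (z 1 • G₂ z) =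
      blockDiag k₁ k₂ z * Matrix.fromRows (G₁ z) (G₂ z) := by
    rw [blockDiag, Matrix.fromBlocks_mul_fromRows]
    simp
  have h1 := hUX ⟨z, hz⟩
  rw [← Matrix.fromBlocks_toBlocks U, hd, Matrix.fromBlocks_mul_fromRows] at h1
  obtain ⟨h2, h3⟩ := Matrix.fromRows_inj h1
  rw [Matrix.mul_one] at h2 h3
  set G := Matrix.fromRows (G₁ z) (G₂ z)
  have h4 : (1 - U.toBlocks₂₂ * blockDiag k₁ k₂ z) * G = U.toBlocks₂₁ := by
    rw [Matrix.sub_mul, Matrix.one_mul, Matrix.mul_assoc, sub_eq_iff_eq_add]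
    exact h3.symm
  have h5 : G = (1 - U.toBlocks₂₂ * blockDiag k₁ k₂ z)⁻¹ * U.toBlocks₂₁ := by
    rw [← h4, Matrix.nonsing_inv_mul_cancel_left]
    exact (det_one_sub_ne_zero hU hz).isUnit
  rw [transferFunction, Matrix.mul_assoc (U.toBlocks₁₂ * _), ← h5, Matrix.mul_assoc, h2]

/-- Each Leibniz term takes one entry from every column. -/
lemma degreeOf_det_le {n : Type*} [Fintype n] [DecidableEq n] (a : Fin 2)
    (M : Matrix n n (MvPolynomial (Fin 2) ℂ)) (b : n → ℕ)
    (h : ∀ i j, (M i j).degreeOf a ≤ b j) : M.det.degreeOf a ≤ ∑ j, b j := by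
  rw [Matrix.det_apply]
  refine (MvPolynomial.degreeOf_sum_le a _ _).trans (Finset.sup_le fun σ _ => ?_)
  rw [Units.smul_def, zsmul_eq_mul]
  refine (MvPolynomial.degreeOf_mul_le _ _ _).trans ?_
  have h0 : ((((Equiv.Perm.sign σ : ℤˣ) : ℤ) : MvPolynomial (Fin 2) ℂ)).degreeOf a = 0 := by
    rw [← map_intCast (MvPolynomial.C : ℂ →+* MvPolynomial (Fin 2) ℂ), MvPolynomial.degreeOf_C]
  rw [h0, zero_add]
  exact (MvPolynomial.degreeOf_prod_le a _ _).trans (Finset.sum_le_sum fun j _ => h _ _)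

/-- The polynomial matrix `A d(z)`. -/
noncomputable def mulBlockDiag {n : Type*} (A : Matrix n (Fin k₁ ⊕ Fin k₂) ℂ) :
    Matrix n (Fin k₁ ⊕ Fin k₂) (MvPolynomial (Fin 2) ℂ) :=
  Matrix.of fun i j =>
    MvPolynomial.C (A i j) * MvPolynomial.X (Sum.elim (fun _ => 0) (fun _ => 1) j)

lemma evalMv_mulBlockDiag {n : Type*} (z : Fin 2 → ℂ) (A : Matrix n (Fin k₁ ⊕ Fin k₂) ℂ) :
    evalMv z (mulBlockDiag A) = A * blockDiag k₁ k₂ z := by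
  ext1 i j
  rw [blockDiag_eq, Matrix.mul_diagonal]
  simp [evalMv, mulBlockDiag]

/-- The numerator of the determinant of an inner function bounds the size of its realizations. -/
theorem degreeOf_le_of_hasRealization {φ : (Fin 2 → ℂ) → Matrix (Fin N) (Fin N) ℂ}
    {gt g : MvPolynomial (Fin 2) ℂ} (hg : IsLowestTerms (fun z => (φ z).det) gt g) (hgt : gt ≠ 0)
    (h : HasRealization φ k₁ k₂) : gt.degreeOf 0 ≤ k₁ ∧ gt.degreeOf 1 ≤ k₂ := by
  obtain ⟨U, hU, hφ⟩ := h
  let c : Fin k₁ ⊕ Fin k₂ → Fin 2 := Sum.elim (fun _ => 0) (fun _ => 1)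
  let M := 1 - mulBlockDiag U.toBlocks₂₂
  let P := Matrix.fromBlocks (U.toBlocks₁₁.map MvPolynomial.C) (mulBlockDiag U.toBlocks₁₂)
    (-(U.toBlocks₂₁.map MvPolynomial.C)) M
  have hM : ∀ z, evalMv z M = 1 - U.toBlocks₂₂ * blockDiag k₁ k₂ z := fun z => by
    rw [← evalMv_mulBlockDiag]
    ext1 i j
    by_cases hij : i = j <;> simp [evalMv, M, hij]
  have hP : ∀ z, evalMv z P = Matrix.fromBlocks U.toBlocks₁₁ (U.toBlocks₁₂ * blockDiag k₁ k₂ z)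
      (-U.toBlocks₂₁) (1 - U.toBlocks₂₂ * blockDiag k₁ k₂ z) := fun z => by
    rw [← hM, ← evalMv_mulBlockDiag, evalMv, Matrix.fromBlocks_map]
    refine Matrix.fromBlocks_inj.2 ⟨?_, rfl, ?_, rfl⟩ <;> ext1 i j <;> simp
  have hδ : ∀ z ∈ bidisk, MvPolynomial.eval z M.det ≠ 0 := fun z hz => by
    rw [← det_evalMv, hM]
    exact det_one_sub_ne_zero hU hz
  -- By the Schur complement, `P.det / M.det` is the determinant of the transfer function.
  have hdet : gt * M.det = P.det * g := by
    refine eq_of_eval_bidisk fun z hz => ?_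
    have h1 : (evalMv z P).det = (evalMv z M).det * (φ z).det := by
      have hu : IsUnit (evalMv z M).det := by
        rw [det_evalMv]
        exact (hδ z hz).isUnit
      have := Matrix.invertibleOfIsUnitDet _ hu
      rw [hP, ← hM, Matrix.det_fromBlocks₂₂, hφ z hz, transferFunction, Matrix.invOf_eq_nonsing_inv,
        ← hM, Matrix.mul_neg, sub_neg_eq_add]
    have h2 := hg.eq_div z hz
    rw [eq_div_iff (hg.ne_zero z hz)] at h2
    rw [map_mul, map_mul, ← det_evalMv, ← det_evalMv, h1, mul_assoc, h2, mul_comm]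
  have h0 : (0 : Fin 2 → ℂ) ∈ bidisk := fun j => by simp
  have hMne : M.det ≠ 0 := fun h => hδ 0 h0 (by rw [h, map_zero])
  have hPne : P.det ≠ 0 := fun h => mul_ne_zero hgt hMne (by rw [hdet, h, zero_mul])
  have hdvd : gt ∣ P.det := hg.relPrime.dvd_of_dvd_mul_right (Dvd.intro _ hdet)
  obtain ⟨β, hβ⟩ := hdvd
  have hβ0 : β ≠ 0 := by rintro rfl; exact hPne (by rw [hβ, mul_zero])
  have hX : ∀ (a : Fin 2) (u : ℂ) j,
      (MvPolynomial.C u * MvPolynomial.X (c j) : MvPolynomial (Fin 2) ℂ).degreeOf a ≤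
        if c j = a then 1 else 0 := fun a u j => by
    refine (MvPolynomial.degreeOf_mul_le _ _ _).trans ?_
    rw [MvPolynomial.degreeOf_C, zero_add, MvPolynomial.degreeOf_X]
    split_ifs <;> simp_all
  -- Each state column is affine in its own variable and free of the other; the input columns are
  -- constant.
  have hPdeg : ∀ a, P.det.degreeOf a ≤ ∑ j, if c j = a then 1 else 0 := fun a => by
    refine (degreeOf_det_le a P (Sum.elim 0 fun j => if c j = a then 1 else 0) ?_).trans
      (by simp [Fintype.sum_sum_type (α₁ := Fin N)])
    rintro (i | i) (j | j)
    · simp [P, MvPolynomial.degreeOf_C]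
    · exact hX a (U.toBlocks₁₂ i j) j
    · change (-(MvPolynomial.C (U.toBlocks₂₁ i j) : MvPolynomial (Fin 2) ℂ)).degreeOf a ≤ 0
      rw [← map_neg, MvPolynomial.degreeOf_C]
    · have h1 : ((1 : Matrix (Fin k₁ ⊕ Fin k₂) (Fin k₁ ⊕ Fin k₂) (MvPolynomial (Fin 2) ℂ)) i
          j).degreeOf a = 0 := by
        rw [Matrix.one_apply]
        split_ifs
        · exact MvPolynomial.degreeOf_one a
        · exact MvPolynomial.degreeOf_zero a
      refine (MvPolynomial.degreeOf_sub_le _ _ _).trans (max_le (h1.trans_le (Nat.zero_le _)) ?_)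
      exact hX a (U.toBlocks₂₂ i j) j
  have hle : ∀ a, gt.degreeOf a ≤ ∑ j, if c j = a then 1 else 0 := fun a => by
    refine le_trans ?_ (hPdeg a)
    rw [hβ, MvPolynomial.degreeOf_mul_eq hgt hβ0]
    exact Nat.le_add_right _ _
  have h1 := hle 0
  have h2 := hle 1
  rw [Fintype.sum_sum_type] at h1 h2
  exact ⟨by simpa [c] using h1, by simpa [c] using h2⟩

end Realization

/-! ### Existence and minimality -/

/-- A rational inner function on the bidisk has a realization whose size is controlled by the
numerator of its determinant. -/
theorem exists_hasRealization {N : ℕ} {φ : (Fin 2 → ℂ) → Matrix (Fin N) (Fin N) ℂ}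
    (hφ : IsRationalInner φ) {gt g : MvPolynomial (Fin 2) ℂ}
    (hg : IsLowestTerms (fun z => (φ z).det) gt g) :
    gt ≠ 0 ∧ ∃ r ≤ gt.degreeOf 0, ∃ s ≤ gt.degreeOf 1, HasRealization φ r s := by
  obtain ⟨hin, Q, p, hp, hQ⟩ := hφ
  have h0 : (0 : Fin 2 → ℂ) ∈ bidisk := fun j => by simp
  have hdet : Q.det * g = gt * p ^ N := by
    refine eq_of_eval_bidisk fun z hz => ?_
    have h1 := hg.eq_div z hz
    rw [eq_div_iff (hg.ne_zero z hz)] at h1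
    rw [map_mul, map_mul, map_pow, ← h1, ← det_evalMv, ← eval_smul_eq hp hQ hz, Matrix.det_smul,
      Fintype.card_fin]
    ring
  have hpne : p ≠ 0 := fun h => hp 0 h0 (by rw [h, map_zero])
  have hgne : g ≠ 0 := fun h => hg.ne_zero 0 h0 (by rw [h, map_zero])
  -- At a torus point where `p` does not vanish, `Q` is a nonzero multiple of a unitary, so its
  -- determinant is not the zero polynomial.
  have hgt : gt ≠ 0 := by
    rintro rfl
    rw [zero_mul, mul_eq_zero, or_iff_left hgne] at hdet
    obtain ⟨z, hz, hpz⟩ := exists_torus_eval_ne_zero hpne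
    have h1 := congrArg Matrix.det (torus_gram hin hp hQ hz)
    rw [Matrix.det_mul, det_evalMv, hdet, map_zero, mul_zero, Matrix.det_smul, Matrix.det_one,
      mul_one] at h1
    exact pow_ne_zero _ (mul_ne_zero ((_root_.map_ne_zero _).2 hpz) hpz) h1.symm
  have hev : ∀ (f : MvPolynomial (Fin 2) ℂ) (x y : ℂ),
      (toBi f).evalEval x y = MvPolynomial.eval ![y, x] f := fun f x y => evalEval_toBi ![y, x] f
  have hmem : ∀ {x y : ℂ}, ‖x‖ < 1 → ‖y‖ < 1 → ![y, x] ∈ bidisk := fun hx hy j => by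
    fin_cases j <;> simpa
  obtain ⟨r, hr, s, hs, G₁, G₂, h⟩ := exists_colligation (Q.map toBi) (toBi p) (toBi gt) (toBi g)
    (fun x y hx hy => by rw [hev]; exact hp _ (hmem hx hy))
    (fun x y hx hy => by rw [hev]; exact hg.ne_zero _ (hmem hx hy))
    ((map_ne_zero_iff toBi toBi.injective).2 hgt)
    (by
      have h1 : (Q.map toBi).det = toBi Q.det := 
        (AlgHom.map_det (toBi : MvPolynomial (Fin 2) ℂ →ₐ[ℂ] ℂ[X][X]) Q).symm
      rw [h1, ← map_mul, hdet, map_mul, map_pow, Fintype.card_fin])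
    (isRelPrime_toBi hg.relPrime)
    (fun x y hx hy => by
      rw [evalM₂_toBi, hev]
      exact torus_gram hin hp hQ fun j => by fin_cases j <;> simpa)
    (fun x y hx hy i j => by
      rw [Matrix.map_apply, hev, hev]
      refine norm_eval_le hin hp hQ (fun k => ?_) i j
      fin_cases k
      · exact hy.le
      · exact hx.le)
  refine ⟨hgt, r, hr.trans (natDegree_toBi gt).le, s, hs.trans (natDegree_coeff_toBi_le gt _),
    hasRealization_of_colligation (fun z => G₁ (z 1) (z 0)) (fun z => G₂ (z 1) (z 0))
      fun w hw z hz => ?_⟩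
  have hφ : ∀ z ∈ bidisk, ((toBi p).evalEval (z 1) (z 0))⁻¹ • evalM₂ (z 1) (z 0) (Q.map toBi) =
      φ z := fun z hz => by
    have h1 : evalM₂ (z 1) (z 0) (Q.map toBi) = evalMv z Q := by
      ext1 i j
      exact evalEval_toBi z (Q i j)
    rw [h1, evalEval_toBi, ← eval_smul_eq hp hQ hz, inv_smul_smul₀ (hp z hz)]
  have h1 := h (z 1) (z 0) (w 1) (w 0) (hz 1) (hz 0) (hw 1) (hw 0)
  rwa [hφ w hw, hφ z hz] at h1

end BidiskInner

theorem mainTheorem6 {N : ℕ} (φ : (Fin 2 → ℂ) → Matrix (Fin N) (Fin N) ℂ)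
    (hφ : BidiskInner.IsRationalInner φ) (gt g : MvPolynomial (Fin 2) ℂ)
    (hg : BidiskInner.IsLowestTerms (fun z => (φ z).det) gt g) :
    BidiskInner.HasRealization φ (gt.degreeOf 0) (gt.degreeOf 1) ∧
      ∀ k₁ k₂ : ℕ, BidiskInner.HasRealization φ k₁ k₂ →
        N + (gt.degreeOf 0 + gt.degreeOf 1) ≤ N + (k₁ + k₂) := by
  obtain ⟨hgt, r, hr, s, hs, h⟩ := BidiskInner.exists_hasRealization hφ hg
  obtain ⟨hr', hs'⟩ := BidiskInner.degreeOf_le_of_hasRealization hg hgt h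
  -- The lower bound applied to the constructed realization forces its block sizes to be exactly the
  -- two degrees.
  rw [le_antisymm hr' hr, le_antisymm hs' hs]
  refine ⟨h, fun k₁ k₂ hk => ?_⟩
  obtain ⟨h1, h2⟩ := BidiskInner.degreeOf_le_of_hasRealization hg hgt hk
  omega
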